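/- **Theorem (bias error on $P_h$ when using the time-lifted reformulation).** *Setting.* Let $F\ge 1$, $h_h>0$, $h_l=Fh_h$. A high-rate plant $P_h$ and a low-rate controller $K_l$ are discrete-time LTI systems with real finite-dimensional state-space realizations. They form the multirate loop $y_h=P_hu_h+v_h$, $u_h=r_h-\mathcal H_uK_l\mathcal S_d\,y_h$, where $\mathcal S_d$ keeps every $F$-th sample and $\mathcal H_u$ holds a sample for $F$ high-rate steps. $K_l$ stabilizes the loop: there is no singular algebraic loop, and the closed-loop state matrix over one period has all eigenvalues in the open unit disc. The initial states are arbitrary. The noise $v_h$ is integrable with mean zero and is independent of the (deterministic or random) excitation $r_h$. Underlining denotes time lifting (stacking $F$ consecutive samples). $\underline P$ is the lifted plant, and $\underline S=(I+\underline K\,\underline P)^{-1}$, $\underline J=(I+\underline P\,\underline K)^{-1}\underline P$ are the lifted systems from $r_h$ to $u_h$ and to $y_h$, where $\underline K$ is the lifting of $\mathcal H_uK_l\mathcal S_d$. *Estimator.* Let $N\ge1$ be the number of periods in the record, $\omega_k=2\pi k/N$, and let $\underline R,\underline U,\underline Y$ be the $N$-point DFTs (with factor $N^{-1/2}$, $N$-periodically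 extended) of the lifted signals $r_h,u_h,y_h$. For polynomial degree $R$ and half window $n$ put $K_1(r)=[1,r,\dots,r^R]^\top$, let $K_n$ have the columns $\begin{bmatrix}K_1(r)\otimes\underline R(k+r)\\K_1(r)\end{bmatrix}$, $r=-n,\dots,n$, and assume that $K_nK_n^H$ is almost surely invertible. Put $W=K_n^H(K_nK_n^H)^{-1}[I\;0\cdots0]^\top$, with rows $W_r$. The LPM estimates at bin $k$ are $\widehat{\underline J}=\underline Y_nW$ and $\widehat{\underline S}=\underline U_nW$, where $X_n=[X(k-n)\cdots X(k+n)]$. Further, $\widehat{\underline P}=\widehat{\underline J}\,\widehat{\underline S}^{-1}$ and, for real $\omega$ with $\omega h_l=\omega_k$, $\widehat{P_h}(e^{j\omega h_h})=\sum_{\sigma=0}^{F-1}\widehat{\underline P}_{[\sigma+1,1]}(e^{j\omega h_l})e^{-\sigma j\omega h_h}$ ($[p,q]$ denotes blocks of size output$\times$input dimension). Let $d$ be the loop state (plant and controller) at the beginning minus that at the end of the record. Assume that $W_r$, $\underline R(k+r)W_r$ and $dW_r$ are integrable and that $e^{j\omega h_l}$ is not an eigenvalue of the state matrix of the lifted plant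 or of the controller. *Error terms.* For $X\in\{\underline J,\underline S\}$ let $T_X(\omega')=N^{-1/2}C(zI-A)^{-1}z\,d$, $z=e^{j\omega'}$, be its transient, with $A$ and $C$ the state and output matrices of the realization of $X$ on the combined loop state, and let $\rho^R_r[f]=f(\omega_{k+r})-\sum_{s=0}^R\frac{f^{(s)}(\omega_k)}{s!}\big(\tfrac{2\pi r}{N}\big)^s$. Define $$X_\Delta=\underbrace{\mathbb E\sum_{r=-n}^n\rho^R_r[X(e^{j\,\cdot})]\,\underline R(k+r)W_r}_{\text{polynomial interpolation error}}+\underbrace{\mathbb E\sum_{r=-n}^n\rho^R_r[T_X]\,W_r}_{\text{leakage error}} .$$ *Conclusions* (all lifted quantities at $e^{j\omega h_l}$, i.e. at bin $k$; $\|\cdot\|$ is the Frobenius norm). 1. The lifted loop is regular: $\underline S(I+\underline K\,\underline P)=I$, $I+\underline P\,\underline K$ is invertible, $(I+\underline P\,\underline K)\underline J=\underline P$, and $\underline P=\underline J\,\underline S^{-1}$. Moreover $\widehat{\underline J},\widehat{\underline S}$ are integrable, $\mathbb E\widehat{\underline J}-\underline J=\underline J_\Delta$ and $\mathbb E\widehat{\underline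 S}-\underline S=\underline S_\Delta$. 2. There is a constant $C$ depending only on $P_h,K_l$ (with their realizations), $F,R$ (not on $N,n,k$, the excitation or the noise) such that, with $m=\sum_r\|\mathbb E[\underline R(k+r)W_r]\|$ and $\mu=\sum_r\|\mathbb E[dW_r]\|$, for each $X\in\{\underline J,\underline S\}$ there are matrices $O_{\rm int}$, $O_{\rm leak}$ with $X_\Delta=X^{(R+1)}(\omega_k)O_{\rm int}+O_{\rm leak}$, $\|O_{\rm int}\|\le Cm(n/N)^{R+1}$, $\|O_{\rm leak}\|\le C(m+\sqrt N\mu)(n/N)^{R+2}$ and $\|O_{\rm leak}\|\le C\big(m(n/N)^{R+2}+\mu N^{-1/2}(n/N)^{R+1}\big)$. 3. If $\widehat{\underline S}$ is almost surely invertible and $\widehat{P_h}(e^{j\omega h_h})$ is integrable, then $$\mathbb E\big(\widehat{P_h}(e^{j\omega h_h})\big)-P_h(e^{j\omega h_h})=\sum_{\sigma=0}^{F-1}\Big(\big(\underline J_\Delta-\underline P\,\underline S_\Delta\big)\underline S^{-1}\Big)_{[\sigma+1,1]}e^{-\sigma j\omega h_h}-\mathcal E,$$ where $\mathcal E=\mathbb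 E\sum_{\sigma=0}^{F-1}\big((\widehat{\underline J}-\underline P\,\widehat{\underline S})\underline S^{-1}(\widehat{\underline S}-\underline S)\widehat{\underline S}^{-1}\big)_{[\sigma+1,1]}e^{-\sigma j\omega h_h}$ is of second order in the estimation errors: if $\widehat{\underline S}$ is almost surely invertible with $\|\widehat{\underline S}^{-1}\|\le\kappa$ and $\widehat{\underline J},\widehat{\underline S}$ are square integrable, then $\widehat{P_h}(e^{j\omega h_h})$ is integrable and $$\|\mathcal E\|\le F\kappa\|\underline S^{-1}\|(1+\|\underline P\|)\big(\|\underline J_\Delta\|^2+\|\underline S_\Delta\|^2+\mathbb E\|\widehat{\underline J}-\mathbb E\widehat{\underline J}\|^2+\mathbb E\|\widehat{\underline S}-\mathbb E\widehat{\underline S}\|^2\big).$$ So, to first order, the bias consists only of LPM interpolation and leakage errors and contains no LPTV effects. 4. The bias repeats over $F$ frequencies: for every integer $f$, replacing $\omega$ by $\omega+f\frac{2\pi}{h_l}$ (that is, $k$ by $k+fN$) changes neither $e^{j\omega h_l}$ nor $\widehat{\underline P}$, $\underline J_\Delta$, $\underline S_\Delta$. -/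

import Mathlib

open MeasureTheory ProbabilityTheory
open scoped Matrix Matrix.Norms.Frobenius

noncomputable section

/-! ### Discrete-time LTI systems and time lifting -/

/-- A discrete-time LTI system `x[t+1] = A x[t] + B u[t]`, `y[t] = C x[t] + D u[t]`
with real coefficients; `X`, `U`, `Y` index the state, the input and the output. -/
structure LTISystem (X U Y : Type*) where
  A : Matrix X X ℝ
  B : Matrix X U ℝ
  C : Matrix Y X ℝ
  D : Matrix Y U ℝ

/-- A real matrix read as a complex one. -/
def toComplex {m n : Type*} (M : Matrix m n ℝ) : Matrix m n ℂ := M.map (fun a => (a : ℂ))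

/-- The transfer matrix `C (z I - A)⁻¹ B + D`. -/
def LTISystem.tf {X U Y : Type*} [Fintype X] [DecidableEq X]
    (G : LTISystem X U Y) (z : ℂ) : Matrix Y U ℂ :=
  toComplex G.C * (z • (1 : Matrix X X ℂ) - toComplex G.A)⁻¹ * toComplex G.B + toComplex G.D

/-- The time-lifted signal: `F` consecutive samples stacked into one vector. -/
def timeLift {ι : Type*} (F : ℕ) (s : ℕ → ι → ℝ) : ℕ → Fin F × ι → ℝ :=
  fun l p => s (l * F + p.1) p.2

/-- The time-lifted representation of an LTI system: the LTI system that maps the lifted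
input to the lifted output, its state being the state at the times `l F`. -/
def LTISystem.lift {X U Y : Type*} [Fintype X] [DecidableEq X] (F : ℕ)
    (G : LTISystem X U Y) : LTISystem X (Fin F × U) (Fin F × Y) where
  A := G.A ^ F
  B := Matrix.of fun a q => (G.A ^ (F - 1 - (q.1 : ℕ)) * G.B) a q.2
  C := Matrix.of fun p a => (G.C * G.A ^ (p.1 : ℕ)) p.2 a
  D := Matrix.of fun p q =>
    if (q.1 : ℕ) < p.1 then (G.C * G.A ^ ((p.1 : ℕ) - q.1 - 1) * G.B) p.2 q.2
    else if q.1 = p.1 then G.D p.2 q.2 else 0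

/-- The lifted downsampler `[I 0 ⋯ 0]`. -/
def liftedDownsampler (F : ℕ) (Y : Type*) [DecidableEq Y] : Matrix Y (Fin F × Y) ℝ :=
  Matrix.of fun a p => if (p.1 : ℕ) = 0 ∧ a = p.2 then 1 else 0

/-- The lifted zero-order hold `[I I ⋯ I]ᵀ`. -/
def liftedHold (F : ℕ) (U : Type*) [DecidableEq U] : Matrix (Fin F × U) U ℝ :=
  Matrix.of fun p a => if p.2 = a then 1 else 0

/-- The low-rate controller between downsampler and hold, acting on lifted signals. -/
def LTISystem.sampledHeld {Z U Y : Type*} [Fintype U] [DecidableEq U] [Fintype Y] [DecidableEq Y]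
    (F : ℕ) (K : LTISystem Z Y U) : LTISystem Z (Fin F × Y) (Fin F × U) where
  A := K.A
  B := K.B * liftedDownsampler F Y
  C := liftedHold F U * K.C
  D := liftedHold F U * K.D * liftedDownsampler F Y

/-! ### The feedback loop `y = G u`, `u = r - K y` -/

/-- The system `S = (I + K G)⁻¹` from `r` to `u`; its state consists of the states of `G`
and `K`. -/
def inputSensitivity {X Z U Y : Type*} [Fintype X] [Fintype Z] [Fintype U] [DecidableEq U]
    [Fintype Y] (G : LTISystem X U Y) (K : LTISystem Z Y U) : LTISystem (X ⊕ Z) U U :=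
  let E : Matrix U U ℝ := (1 + K.D * G.D)⁻¹
  { A := Matrix.fromBlocks
      (G.A - G.B * E * K.D * G.C) (-(G.B * E * K.C))
      (K.B * (G.C - G.D * E * K.D * G.C)) (K.A - K.B * G.D * E * K.C)
    B := Matrix.fromRows (G.B * E) (K.B * G.D * E)
    C := Matrix.fromCols (-(E * K.D * G.C)) (-(E * K.C))
    D := E }

/-- The system `J = (I + G K)⁻¹ G` from `r` to `y`, with the same state. -/
def processSensitivity {X Z U Y : Type*} [Fintype X] [Fintype Z] [Fintype U] [DecidableEq U]
    [Fintype Y] (G : LTISystem X U Y) (K : LTISystem Z Y U) : LTISystem (X ⊕ Z) U Y :=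
  let E : Matrix U U ℝ := (1 + K.D * G.D)⁻¹
  { A := (inputSensitivity G K).A
    B := (inputSensitivity G K).B
    C := Matrix.fromCols (G.C - G.D * E * K.D * G.C) (-(G.D * E * K.C))
    D := G.D * E }

/-- The lifted closed-loop system from the excitation `r_h` to the plant input `u_h`. -/
def liftedS {X Z U Y : Type*} [Fintype X] [DecidableEq X] [Fintype Z] [Fintype U] [DecidableEq U]
    [Fintype Y] [DecidableEq Y] (F : ℕ) (P : LTISystem X U Y) (K : LTISystem Z Y U) :
    LTISystem (X ⊕ Z) (Fin F × U) (Fin F × U) :=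
  inputSensitivity (P.lift F) (K.sampledHeld F)

/-- The lifted closed-loop system from the excitation `r_h` to the plant output `y_h`. -/
def liftedJ {X Z U Y : Type*} [Fintype X] [DecidableEq X] [Fintype Z] [Fintype U] [DecidableEq U]
    [Fintype Y] [DecidableEq Y] (F : ℕ) (P : LTISystem X U Y) (K : LTISystem Z Y U) :
    LTISystem (X ⊕ Z) (Fin F × U) (Fin F × Y) :=
  processSensitivity (P.lift F) (K.sampledHeld F)

/-- The low-rate controller `K` stabilizes the high-rate plant `P`: the multirate loop has no
singular algebraic loop, and the closed-loop state matrix over one period is Schur stable. -/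
def Stabilizing {X Z U Y : Type*} [Fintype X] [DecidableEq X] [Fintype Z] [DecidableEq Z]
    [Fintype U] [DecidableEq U] [Fintype Y] [DecidableEq Y]
    (F : ℕ) (P : LTISystem X U Y) (K : LTISystem Z Y U) : Prop :=
  IsUnit (1 + K.D * P.D).det ∧
    ∀ a ∈ spectrum ℂ (toComplex (liftedS F P K).A), ‖a‖ < 1

/-- The signals in the multirate loop: plant state `x`, excitation `r`, noise `v`, plant input
`u`, plant output `y` at the high rate; controller state `ξ` and controller output `c` at the
low rate. -/
structure LoopSignals (X Z U Y : Type*) where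
  x : ℕ → X → ℝ
  r : ℕ → U → ℝ
  v : ℕ → Y → ℝ
  u : ℕ → U → ℝ
  y : ℕ → Y → ℝ
  ξ : ℕ → Z → ℝ
  c : ℕ → U → ℝ

/-- The signals obey the multirate loop: the plant at the high rate with additive output noise,
the controller at the low rate reading every `F`-th output sample, and its output held over `F`
samples and subtracted from the excitation. The initial states are arbitrary. -/
structure LoopSignals.IsTrajectory {X Z U Y : Type*} [Fintype X] [Fintype Z] [Fintype U]
    [Fintype Y] (F : ℕ) (P : LTISystem X U Y) (K : LTISystem Z Y U)
    (s : LoopSignals X Z U Y) : Prop where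
  plant_state : ∀ t, s.x (t + 1) = P.A *ᵥ s.x t + P.B *ᵥ s.u t
  plant_output : ∀ t, s.y t = P.C *ᵥ s.x t + P.D *ᵥ s.u t + s.v t
  controller_state : ∀ l, s.ξ (l + 1) = K.A *ᵥ s.ξ l + K.B *ᵥ s.y (l * F)
  controller_output : ∀ l, s.c l = K.C *ᵥ s.ξ l + K.D *ᵥ s.y (l * F)
  plant_input : ∀ l i, i < F → s.u (l * F + i) = s.r (l * F + i) - s.c l

/-- The loop state at the beginning of a record of `N` periods minus the one at its end. -/
def LoopSignals.stateDrop {X Z U Y : Type*} (F N : ℕ) (s : LoopSignals X Z U Y) : X ⊕ Z → ℝ :=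
  Sum.elim (s.x 0 - s.x (N * F)) (s.ξ 0 - s.ξ N)

/-! ### Local polynomial modeling -/

/-- The DFT of the first `N` samples, at an arbitrary integer bin. -/
def dft {ι : Type*} (N : ℕ) (s : ℕ → ι → ℝ) (k : ℤ) : ι → ℂ := fun i =>
  ((Real.sqrt N : ℝ) : ℂ)⁻¹ *
    ∑ t ∈ Finset.range N, (s t i : ℂ) * Complex.exp (-(2 * Real.pi * t * k / N * Complex.I))

/-- The window `{-n, …, n}`. -/
abbrev Window (n : ℕ) : Type := ↥(Finset.Icc (-(n : ℤ)) (n : ℤ))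

/-- The matrix `[W(k-n) ⋯ W(k+n)]`. -/
def windowMatrix {ι : Type*} (n : ℕ) (k : ℤ) (W : ℤ → ι → ℂ) : Matrix ι (Window n) ℂ :=
  Matrix.of fun i r => W (k + r.1) i

/-- The LPM regressor `K_n`, whose column `r` is `[K₁(r) ⊗ U(k+r); K₁(r)]` with
`K₁(r) = [1, r, …, r^R]ᵀ`. -/
def regressor {ι : Type*} (R n : ℕ) (k : ℤ) (W : ℤ → ι → ℂ) :
    Matrix ((Fin (R + 1) × ι) ⊕ Fin (R + 1)) (Window n) ℂ :=
  Matrix.of fun a r => Sum.elim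
    (fun p : Fin (R + 1) × ι => (r.1 : ℂ) ^ (p.1 : ℕ) * W (k + r.1) p.2)
    (fun s : Fin (R + 1) => (r.1 : ℂ) ^ (s : ℕ)) a

/-- The matrix `K_nᴴ (K_n K_nᴴ)⁻¹ [I 0 ⋯ 0]ᵀ` that LPM applies to the output data. -/
def lpmWeight {ι : Type*} [Fintype ι] [DecidableEq ι] (R n : ℕ) (k : ℤ) (W : ℤ → ι → ℂ) :
    Matrix (Window n) ι ℂ :=
  ((regressor R n k W)ᴴ * (regressor R n k W * (regressor R n k W)ᴴ)⁻¹).submatrix id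
    (fun i => Sum.inl (0, i))

/-- The LPM estimate, at bin `k`, of the transfer matrix from a signal with DFT `W` to a signal
with DFT `V`. -/
def lpmEstimate {ι κ : Type*} [Fintype ι] [DecidableEq ι] (R n : ℕ) (k : ℤ)
    (W : ℤ → ι → ℂ) (V : ℤ → κ → ℂ) : Matrix κ ι ℂ :=
  windowMatrix n k V * lpmWeight R n k W

/-! ### The LPM errors -/

/-- The DFT frequency `2πk/N` in radians per sample. -/
def binFreq (N : ℕ) (k : ℤ) : ℝ := 2 * Real.pi * k / N

/-- The remainder at `a + h` of the Taylor expansion of `f` of degree `R` around `a`. -/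
def taylorRemainder (R : ℕ) (f : ℝ → ℂ) (a h : ℝ) : ℂ :=
  f (a + h) - ∑ s ∈ Finset.range (R + 1), iteratedDeriv s f a / (Nat.factorial s : ℂ) * (h : ℂ) ^ s

/-- The entrywise expectation of a random matrix. -/
def expect {Ω m n : Type*} [MeasurableSpace Ω] (μ : Measure Ω) (M : Ω → Matrix m n ℂ) :
    Matrix m n ℂ :=
  Matrix.of fun i j => ∫ ω, M ω i j ∂μ

/-- The transient term in `Y(k) = G(e^{jω_k}) U(k) + T(e^{jω_k})` for a record of `N` samples
over which the state of `G` drops by `d`. -/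
def transient {X U Y : Type*} [Fintype X] [DecidableEq X] (G : LTISystem X U Y) (N : ℕ)
    (d : X → ℝ) (z : ℂ) : Y → ℂ :=
  (((Real.sqrt N : ℝ) : ℂ)⁻¹ * z) •
    ((toComplex G.C * (z • (1 : Matrix X X ℂ) - toComplex G.A)⁻¹) *ᵥ fun a => (d a : ℂ))

/-- The polynomial interpolation error of LPM: the LPM weights applied to what remains of
`G(e^{jω})` times the input after subtraction of the Taylor polynomial of `G` of degree `R`. -/
def interpolationError {Ω X ι κ : Type*} [MeasurableSpace Ω] [Fintype X] [DecidableEq X]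
    [Fintype ι] [DecidableEq ι] (μ : Measure Ω) (R n N : ℕ) (k : ℤ) (G : LTISystem X ι κ)
    (W : Ω → ℤ → ι → ℂ) : Matrix κ ι ℂ :=
  expect μ fun ω => Matrix.of (fun (i : κ) (r : Window n) =>
    ∑ q, taylorRemainder R (fun θ => G.tf (Complex.exp (θ * Complex.I)) i q)
      (binFreq N k) (2 * Real.pi * r.1 / N) * W ω (k + r.1) q) * lpmWeight R n k (W ω)

/-- The leakage error of LPM: the LPM weights applied to what remains of the transient after
subtraction of its Taylor polynomial of degree `R`. -/
def leakageError {Ω X ι κ : Type*} [MeasurableSpace Ω] [Fintype X] [DecidableEq X]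
    [Fintype ι] [DecidableEq ι] (μ : Measure Ω) (R n N : ℕ) (k : ℤ) (G : LTISystem X ι κ)
    (W : Ω → ℤ → ι → ℂ) (d : Ω → X → ℝ) : Matrix κ ι ℂ :=
  expect μ fun ω => Matrix.of (fun (i : κ) (r : Window n) =>
    taylorRemainder R (fun θ => transient G N (d ω) (Complex.exp (θ * Complex.I)) i)
      (binFreq N k) (2 * Real.pi * r.1 / N)) * lpmWeight R n k (W ω)

/-- The error term `X_Δ`: interpolation error plus leakage error. -/
def lpmError {Ω X ι κ : Type*} [MeasurableSpace Ω] [Fintype X] [DecidableEq X]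
    [Fintype ι] [DecidableEq ι] (μ : Measure Ω) (R n N : ℕ) (k : ℤ) (G : LTISystem X ι κ)
    (W : Ω → ℤ → ι → ℂ) (d : Ω → X → ℝ) : Matrix κ ι ℂ :=
  interpolationError μ R n N k G W + leakageError μ R n N k G W d

/-- The `s`-th derivative of the frequency response of `G` with respect to frequency. -/
def freqDeriv {X ι κ : Type*} [Fintype X] [DecidableEq X] (s : ℕ) (G : LTISystem X ι κ) (θ : ℝ) :
    Matrix κ ι ℂ :=
  Matrix.of fun i j => iteratedDeriv s (fun t : ℝ => G.tf (Complex.exp (t * Complex.I)) i j) θ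

/-- The size of the cross moments, over the window, of the vectors `a ω r` with the LPM
weights. -/
def crossMoment {Ω ι κ : Type*} [MeasurableSpace Ω] [Fintype κ] [Fintype ι] [DecidableEq ι]
    (μ : Measure Ω) (R n : ℕ) (k : ℤ) (W : Ω → ℤ → ι → ℂ) (a : Ω → Window n → κ → ℂ) : ℝ :=
  ∑ r : Window n, ‖expect μ fun ω => Matrix.vecMulVec (a ω r) (lpmWeight R n k (W ω) r)‖

/-- `X_Δ` has the form `X^{(R+1)} O((n/N)^{R+1}) + O((n/N)^{R+2})` with the constant `C`.
The first `O` collects the leading part of the interpolation error. The second one collects the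
rest of it and the leakage, and is measured by the cross moments of the input DFT and of the
state drop with the LPM weights; its leakage part is also bounded by `N^{-1/2} (n/N)^{R+1}`
times the cross moment of the state drop. -/
def HasLPMOrder {Ω X ι κ : Type*} [MeasurableSpace Ω] [Fintype X] [DecidableEq X]
    [Fintype ι] [DecidableEq ι] [Fintype κ] (C : ℝ) (μ : Measure Ω) (R n N : ℕ) (k : ℤ)
    (G : LTISystem X ι κ) (W : Ω → ℤ → ι → ℂ) (d : Ω → X → ℝ) : Prop :=
  ∃ (Oint : Matrix ι ι ℂ) (Oleak : Matrix κ ι ℂ),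
    lpmError μ R n N k G W d = freqDeriv (R + 1) G (binFreq N k) * Oint + Oleak ∧
    ‖Oint‖ ≤ C * crossMoment μ R n k W (fun ω r => W ω (k + r.1)) * ((n : ℝ) / N) ^ (R + 1) ∧
    ‖Oleak‖ ≤ C * (crossMoment μ R n k W (fun ω r => W ω (k + r.1)) * ((n : ℝ) / N) ^ (R + 2) +
      crossMoment μ R n k W (fun ω _ a => (d ω a : ℂ)) *
        ((Real.sqrt N)⁻¹ * ((n : ℝ) / N) ^ (R + 1))) ∧
    ‖Oleak‖ ≤ C * (crossMoment μ R n k W (fun ω r => W ω (k + r.1)) +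
      Real.sqrt N * crossMoment μ R n k W (fun ω _ a => (d ω a : ℂ))) * ((n : ℝ) / N) ^ (R + 2)

/-! ### The estimate of the high-rate plant -/

/-- Inverse time lifting: `∑_σ M_{[σ+1,1]} z^{-σ}`, where `M_{[p,q]}` are the blocks of `M`. -/
def inverseTimeLift {F : ℕ} [NeZero F] {U Y : Type*} (M : Matrix (Fin F × Y) (Fin F × U) ℂ)
    (z : ℂ) : Matrix Y U ℂ :=
  ∑ σ : Fin F, z⁻¹ ^ (σ : ℕ) • Matrix.of fun (i : Y) (j : U) => M (σ, i) (0, j)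

/-- The DFT of the lifted excitation. -/
def LoopSignals.dftR {X Z U Y : Type*} (F N : ℕ) (s : LoopSignals X Z U Y) :
    ℤ → Fin F × U → ℂ := dft N (timeLift F s.r)

/-- The LPM estimate of the lifted system from `r_h` to `u_h`. -/
def LoopSignals.estS {X Z U Y : Type*} [Fintype U] [DecidableEq U] (F N R n : ℕ) (k : ℤ)
    (s : LoopSignals X Z U Y) : Matrix (Fin F × U) (Fin F × U) ℂ :=
  lpmEstimate R n k (s.dftR F N) (dft N (timeLift F s.u))

/-- The LPM estimate of the lifted system from `r_h` to `y_h`. -/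
def LoopSignals.estJ {X Z U Y : Type*} [Fintype U] [DecidableEq U] (F N R n : ℕ) (k : ℤ)
    (s : LoopSignals X Z U Y) : Matrix (Fin F × Y) (Fin F × U) ℂ :=
  lpmEstimate R n k (s.dftR F N) (dft N (timeLift F s.y))

/-- The indirect estimate of the lifted plant. -/
def LoopSignals.estP {X Z U Y : Type*} [Fintype U] [DecidableEq U] (F N R n : ℕ) (k : ℤ)
    (s : LoopSignals X Z U Y) : Matrix (Fin F × Y) (Fin F × U) ℂ :=
  s.estJ F N R n k * (s.estS F N R n k)⁻¹

/-- The error term `J_Δ` of the experiment `s`. -/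
def errJ {Ω X Z U Y : Type*} [MeasurableSpace Ω] [Fintype X] [DecidableEq X] [Fintype Z]
    [DecidableEq Z] [Fintype U] [DecidableEq U] [Fintype Y] [DecidableEq Y]
    (μ : Measure Ω) (F N R n : ℕ) (k : ℤ) (P : LTISystem X U Y) (K : LTISystem Z Y U)
    (s : Ω → LoopSignals X Z U Y) : Matrix (Fin F × Y) (Fin F × U) ℂ :=
  lpmError μ R n N k (liftedJ F P K) (fun ω => (s ω).dftR F N) (fun ω => (s ω).stateDrop F N)

/-- The error term `S_Δ` of the experiment `s`. -/
def errS {Ω X Z U Y : Type*} [MeasurableSpace Ω] [Fintype X] [DecidableEq X] [Fintype Z]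
    [DecidableEq Z] [Fintype U] [DecidableEq U] [Fintype Y] [DecidableEq Y]
    (μ : Measure Ω) (F N R n : ℕ) (k : ℤ) (P : LTISystem X U Y) (K : LTISystem Z Y U)
    (s : Ω → LoopSignals X Z U Y) : Matrix (Fin F × U) (Fin F × U) ℂ :=
  lpmError μ R n N k (liftedS F P K) (fun ω => (s ω).dftR F N) (fun ω => (s ω).stateDrop F N)

/-- An identification experiment of `N` periods with LPM at bin `k`: the random signals obey the
loop, the noise has mean zero and is independent of the excitation, the excitation is such that
the LPM least-squares problem has a unique solution, and the moments that enter the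
expectations exist. -/
structure IsExperiment {Ω X Z U Y : Type*} [MeasurableSpace Ω] [Fintype X] [Fintype Z]
    [Fintype U] [DecidableEq U] [Fintype Y]
    (μ : Measure Ω) (F N R n : ℕ) (k : ℤ) (P : LTISystem X U Y) (K : LTISystem Z Y U)
    (s : Ω → LoopSignals X Z U Y) : Prop where
  trajectory : ∀ ω, (s ω).IsTrajectory F P K
  indep : IndepFun (fun ω => (s ω).r) (fun ω => (s ω).v) μ
  noise_integrable : ∀ t i, Integrable (fun ω => (s ω).v t i) μ
  noise_mean : ∀ t i, ∫ ω, (s ω).v t i ∂μ = 0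
  exciting : ∀ᵐ ω ∂μ, IsUnit
    (regressor R n k ((s ω).dftR F N) * (regressor R n k ((s ω).dftR F N))ᴴ).det
  weight_integrable : ∀ r j, Integrable (fun ω => lpmWeight R n k ((s ω).dftR F N) r j) μ
  input_integrable : ∀ r q j, Integrable
    (fun ω => (s ω).dftR F N (k + r.1) q * lpmWeight R n k ((s ω).dftR F N) r j) μ
  drop_integrable : ∀ r a j, Integrable
    (fun ω => ((s ω).stateDrop F N a : ℂ) * lpmWeight R n k ((s ω).dftR F N) r j) μ

end

/-! ### Taylor remainders -/

/-! Lifting removes the periodic time variation: sampled at the instants `l F`, the multirate loop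
is an ordinary LTI loop. Over a finite record the DFT turns its recursions into algebraic equations
at `z = e^{jω_k}`; the shift rule `dft_succ` leaves a boundary term proportional to the state drop.
Solving the loop (`loop_response`) shows that each lifted output DFT is exactly response times
excitation, plus transient, plus filtered noise (`LoopSignals.IsTrajectory.dft_eq`). No
cross-frequency term survives, which is why the bias contains no LPTV effect.

The LPM weights are a right inverse of the regressor on the columns of interest. They reproduce a
transfer matrix that is a polynomial of degree `R` in the bin offset and annihilate a polynomial
transient, so only Taylor remainders and noise are left (`lpmEstimate_eq`). The weights depend on
the excitation alone, hence independent zero-mean noise averages out (`noise_mul_lpmWeight`) and the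
bias is `X_Δ` exactly (`lpmEstimate_bias`).

For the order, the poles lie inside the unit disc, so the frequency responses are smooth and
periodic and their derivatives are bounded uniformly in frequency. The transient is itself such a
response applied to a fixed vector. This makes the constant in `LTISystem.exists_hasLPMOrder`
independent of the record and of the signals.

For the plant, `quotient_estimate_eq` is an exact expansion of the quotient of the two estimates: a
term linear in them, whose expectation is explicit, and a product of two errors. Mean square error
being squared bias plus variance, the product is of second order. The first block column of the
lifted plant determines `P_h` through a finite geometric sum (`inv_resolvent_eq_lifted`), and
inverse time lifting is linear, so it carries the expansion over to the high-rate plant. Periodicity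
in `k` holds because every ingredient depends only on `k` modulo `N`. -/

theorem taylorRemainder_at_zero (R : ℕ) (f : ℝ → ℂ) (a : ℝ) : taylorRemainder R f a 0 = 0 := by
  simp [taylorRemainder, Finset.sum_range_succ']

/-- Splits off the leading term of the interpolation error, the one proportional to the derivative
of order `R + 1`. -/
theorem taylorRemainder_eq_add_succ (R : ℕ) (f : ℝ → ℂ) (a h : ℝ) :
    taylorRemainder R f a h =
      iteratedDeriv (R + 1) f a / (Nat.factorial (R + 1) : ℂ) * (h : ℂ) ^ (R + 1) +
        taylorRemainder (R + 1) f a h := by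
  simp only [taylorRemainder]
  rw [Finset.sum_range_succ _ (R + 1)]
  ring

theorem hasDerivAt_taylorRemainder (R : ℕ) {f : ℝ → ℂ} (hf : ContDiff ℝ (⊤ : ℕ∞) f) (a h : ℝ) :
    HasDerivAt (taylorRemainder (R + 1) f a) (taylorRemainder R (deriv f) a h) h := by
  unfold taylorRemainder
  have h1 : HasDerivAt (fun h => f (a + h)) (deriv f (a + h)) h := by
    have := (hf.differentiable (by simp) (a + h)).hasDerivAt
    exact this.comp_const_add a h
  refine h1.sub ?_
  -- The term `s = 0` is constant in `h`. In the others, `(s + 1) / (s + 1)! = 1 / s!` lowers the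
  -- index and yields the Taylor polynomial of `deriv f`.
  simp_rw [Finset.sum_range_succ' _ (R + 1)]
  have h2 : HasDerivAt (fun h : ℝ => ∑ s ∈ Finset.range (R + 1),
      iteratedDeriv (s + 1) f a / (Nat.factorial (s + 1) : ℂ) * (h : ℂ) ^ (s + 1))
      (∑ s ∈ Finset.range (R + 1),
        iteratedDeriv s (deriv f) a / (Nat.factorial s : ℂ) * (h : ℂ) ^ s) h := by
    refine HasDerivAt.fun_sum fun s _ => ?_
    have h3 : HasDerivAt (fun h : ℝ => (h : ℂ) ^ (s + 1)) (((s + 1 : ℕ) : ℂ) * (h : ℂ) ^ s * 1) h := by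
      simpa using (hasDerivAt_pow (s + 1) (h : ℂ)).comp_ofReal
    have h4 := h3.const_mul (iteratedDeriv (s + 1) f a / (Nat.factorial (s + 1) : ℂ))
    refine h4.congr_deriv ?_
    rw [iteratedDeriv_succ', Nat.factorial_succ]
    have : ((s + 1 : ℕ) : ℂ) ≠ 0 := by exact_mod_cast Nat.succ_ne_zero s
    have : ((Nat.factorial s : ℕ) : ℂ) ≠ 0 := by exact_mod_cast Nat.factorial_ne_zero s
    push_cast at *
    field_simp
  simpa using h2.add_const (iteratedDeriv 0 f a / (Nat.factorial 0 : ℂ) * 1)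

/-- Induction on the degree through the mean value inequality, which suits complex-valued functions.
The factor `1 / (R + 1)!` is given up, since only the order matters. -/
theorem norm_taylorRemainder_le {M : ℝ} : ∀ (R : ℕ) {f : ℝ → ℂ}, ContDiff ℝ (⊤ : ℕ∞) f →
    (∀ θ, ‖iteratedDeriv (R + 1) f θ‖ ≤ M) → ∀ a h : ℝ,
    ‖taylorRemainder R f a h‖ ≤ M * |h| ^ (R + 1)
  | 0, f, hf, hM, a, h => by
    have := Convex.norm_image_sub_le_of_norm_deriv_le (𝕜 := ℝ) (f := f) (s := Set.univ) (C := M)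
      (x := a) (y := a + h) (fun x _ => hf.differentiable (by simp) x)
      (fun x _ => by simpa using hM x) convex_univ trivial trivial
    simpa [taylorRemainder] using this
  | R + 1, f, hf, hM, a, h => by
    have hf' : ContDiff ℝ (⊤ : ℕ∞) (deriv f) := by
      simpa using hf.iterate_deriv 1
    have ih := norm_taylorRemainder_le R hf' (fun θ => by
      rw [← iteratedDeriv_succ']; exact hM θ) a
    have hM0 : 0 ≤ M := (norm_nonneg _).trans (hM 0)
    -- On the ball of radius `|h|` the induction hypothesis bounds the derivative by `M * |h| ^ (R +
    -- 1)`. The remainder vanishes at `0`, and the distance to `h` supplies the last factor `|h|`.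
    have := Convex.norm_image_sub_le_of_norm_hasDerivWithin_le (𝕜 := ℝ)
      (f := taylorRemainder (R + 1) f a) (f' := taylorRemainder R (deriv f) a)
      (s := Metric.closedBall 0 |h|) (C := M * |h| ^ (R + 1)) (x := 0) (y := h)
      (fun x _ => (hasDerivAt_taylorRemainder R hf a x).hasDerivWithinAt)
      (fun x hx => (ih x).trans (by
        have : |x| ≤ |h| := by simpa using hx
        gcongr))
      (convex_closedBall 0 |h|) (by simp) (by simp)
    simpa [taylorRemainder_at_zero, pow_succ, mul_assoc] using this

theorem taylorRemainder_sum_mul {ι : Type*} (s : Finset ι) (R : ℕ) {f : ι → ℝ → ℂ}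
    (hf : ∀ q, ContDiff ℝ (⊤ : ℕ∞) (f q)) (c : ι → ℂ) (a h : ℝ) :
    taylorRemainder R (fun θ => ∑ q ∈ s, f q θ * c q) a h =
      ∑ q ∈ s, taylorRemainder R (f q) a h * c q := by
  have hd (m : ℕ) : iteratedDeriv m (fun θ => ∑ q ∈ s, f q θ * c q) a =
      ∑ q ∈ s, iteratedDeriv m (f q) a * c q := by
    rw [iteratedDeriv_fun_sum (fun q _ => (((hf q).mul contDiff_const).of_le
      (by exact_mod_cast le_top)).contDiffAt)]
    exact Finset.sum_congr rfl fun q _ => iteratedDeriv_mul_const_field _ _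
  simp only [taylorRemainder, hd, sub_mul, Finset.sum_sub_distrib, Finset.sum_mul, Finset.sum_div]
  rw [Finset.sum_comm]
  congr 1
  exact Finset.sum_congr rfl fun q _ => Finset.sum_congr rfl fun m _ => by ring

theorem taylorRemainder_add_period (R : ℕ) {f : ℝ → ℂ} {c : ℝ} (hf : Function.Periodic f c)
    (a h : ℝ) : taylorRemainder R f (a + c) h = taylorRemainder R f a h := by
  have hd (m : ℕ) : iteratedDeriv m f (a + c) = iteratedDeriv m f a := by
    have h1 : (fun t => f (t + c)) = f := funext hf
    have := congrFun (iteratedDeriv_comp_add_const m f c) a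
    rw [h1] at this
    exact this.symm
  simp only [taylorRemainder, hd, add_right_comm a c h, hf (a + h)]

/-- All derivatives of a smooth periodic function are bounded. -/
theorem exists_bound_iteratedDeriv {f : ℝ → ℂ} {c : ℝ} (hc : c ≠ 0)
    (hf : ContDiff ℝ (⊤ : ℕ∞) f) (hp : Function.Periodic f c) (m : ℕ) :
    ∃ M, ∀ θ, ‖iteratedDeriv m f θ‖ ≤ M := by
  have hper : Function.Periodic (iteratedDeriv m f) c := fun a => by
    have h1 : (fun t => f (t + c)) = f := funext hp
    have := congrFun (iteratedDeriv_comp_add_const m f c) a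
    rw [h1] at this
    exact this.symm
  have hb := hper.isBounded_of_continuous hc
    (hf.continuous_iteratedDeriv m (by exact_mod_cast le_top))
  obtain ⟨M, hM⟩ := hb.exists_norm_le
  exact ⟨M, fun θ => hM _ ⟨θ, rfl⟩⟩

/-! ### Frequency responses -/

theorem contDiff_matrix_det {m : Type*} [Fintype m] [DecidableEq m] {M : ℝ → Matrix m m ℂ}
    (hM : ∀ i j, ContDiff ℝ (⊤ : ℕ∞) fun θ => M θ i j) :
    ContDiff ℝ (⊤ : ℕ∞) fun θ => (M θ).det := by
  simp only [Matrix.det_apply']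
  exact ContDiff.sum fun σ _ => contDiff_const.mul (contDiff_prod fun i _ => hM _ _)

/-- By Cramer's rule the entries of the inverse are quotients of determinants, hence of polynomials
in the entries. -/
theorem contDiff_matrix_inv {m : Type*} [Fintype m] [DecidableEq m] {M : ℝ → Matrix m m ℂ}
    (hM : ∀ i j, ContDiff ℝ (⊤ : ℕ∞) fun θ => M θ i j) (hdet : ∀ θ, (M θ).det ≠ 0) (i j : m) :
    ContDiff ℝ (⊤ : ℕ∞) fun θ => (M θ)⁻¹ i j := by
  simp only [Matrix.inv_def, Matrix.smul_apply, Ring.inverse_eq_inv', smul_eq_mul,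
    Matrix.adjugate_apply]
  refine ((contDiff_matrix_det hM).inv hdet).mul (contDiff_matrix_det fun a b => ?_)
  by_cases h : a = j
  · subst h; simpa using contDiff_const
  · simpa [Matrix.updateRow_ne h] using hM a b

theorem isUnit_det_resolvent {m : Type*} [Fintype m] [DecidableEq m] {A : Matrix m m ℂ} {z : ℂ}
    (hz : z ∉ spectrum ℂ A) : IsUnit (z • (1 : Matrix m m ℂ) - A).det := by
  rw [← Matrix.isUnit_iff_isUnit_det]
  simpa [spectrum.mem_iff, Algebra.algebraMap_eq_smul_one] using hz

theorem circle_notMem_spectrum {m : Type*} [Fintype m] [DecidableEq m] {A : Matrix m m ℂ}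
    (hA : ∀ a ∈ spectrum ℂ A, ‖a‖ < 1) (θ : ℝ) :
    Complex.exp (θ * Complex.I) ∉ spectrum ℂ A := fun h => by
  have := hA _ h
  simp [Complex.norm_exp_ofReal_mul_I] at this

theorem exp_circle_periodic :
    Function.Periodic (fun θ : ℝ => Complex.exp (θ * Complex.I)) (2 * Real.pi) := fun θ => by
  simp [add_mul, Complex.exp_add, Complex.exp_two_pi_mul_I]

theorem LTISystem.contDiff_tf {X U Y : Type*} [Fintype X] [DecidableEq X] (G : LTISystem X U Y)
    (hG : ∀ a ∈ spectrum ℂ (toComplex G.A), ‖a‖ < 1) (i : Y) (j : U) :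
    ContDiff ℝ (⊤ : ℕ∞) fun θ : ℝ => G.tf (Complex.exp (θ * Complex.I)) i j := by
  have hexp : ContDiff ℝ (⊤ : ℕ∞) fun θ : ℝ => Complex.exp (θ * Complex.I) :=
    (Complex.ofRealCLM.contDiff.mul contDiff_const).cexp
  have hinv := contDiff_matrix_inv (M := fun θ : ℝ =>
      Complex.exp (θ * Complex.I) • (1 : Matrix X X ℂ) - toComplex G.A)
    (fun a b => by
      simp only [Matrix.sub_apply, Matrix.smul_apply, smul_eq_mul]
      exact (hexp.mul contDiff_const).sub contDiff_const)
    (fun θ => (isUnit_det_resolvent (circle_notMem_spectrum hG θ)).ne_zero)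
  simp only [LTISystem.tf, Matrix.add_apply, Matrix.mul_apply]
  exact (ContDiff.sum fun b _ => (ContDiff.sum fun a _ => contDiff_const.mul (hinv a b)).mul
    contDiff_const).add contDiff_const

theorem LTISystem.tf_periodic {X U Y : Type*} [Fintype X] [DecidableEq X] (G : LTISystem X U Y)
    (i : Y) (j : U) : Function.Periodic (fun θ : ℝ => G.tf (Complex.exp (θ * Complex.I)) i j)
      (2 * Real.pi) := fun θ => by
  have := exp_circle_periodic θ
  simp only at this ⊢
  rw [this]

/-- The Taylor remainders of a stable frequency response, uniformly in the frequency. -/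
theorem LTISystem.exists_taylorRemainder_tf_le {X U Y : Type*} [Fintype X] [DecidableEq X]
    [Finite U] [Finite Y] (G : LTISystem X U Y)
    (hG : ∀ a ∈ spectrum ℂ (toComplex G.A), ‖a‖ < 1) (R : ℕ) :
    ∃ M : ℝ, 0 ≤ M ∧ ∀ i j (a h : ℝ),
      ‖taylorRemainder R (fun θ => G.tf (Complex.exp (θ * Complex.I)) i j) a h‖ ≤
        M * |h| ^ (R + 1) := by
  have : Fintype U := Fintype.ofFinite U
  have : Fintype Y := Fintype.ofFinite Y
  choose M hM using fun i j => exists_bound_iteratedDeriv (by positivity : 2 * Real.pi ≠ 0)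
    (G.contDiff_tf hG i j) (G.tf_periodic i j) (R + 1)
  have hM0 (i j) : 0 ≤ M i j := (norm_nonneg _).trans (hM i j 0)
  -- A sum of the entrywise bounds dominates each of them, so one constant serves all entries.
  refine ⟨∑ i, ∑ j, M i j, Finset.sum_nonneg fun i _ => Finset.sum_nonneg fun j _ => hM0 i j,
    fun i j a h => (norm_taylorRemainder_le R (G.contDiff_tf hG i j) (hM i j) a h).trans ?_⟩
  gcongr
  exact (Finset.single_le_sum (f := fun j => M i j) (fun j _ => hM0 i j) (Finset.mem_univ j)).trans
    (Finset.single_le_sum (f := fun i => ∑ j, M i j)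
      (fun i _ => Finset.sum_nonneg fun j _ => hM0 i j) (Finset.mem_univ i))

/-- The LTI system whose transfer matrix is `C (z I - A)⁻¹ z`. -/
def LTISystem.stateResponse {X U Y : Type*} [Fintype X] (G : LTISystem X U Y) :
    LTISystem X X Y where
  A := G.A
  B := G.A
  C := G.C
  D := G.C

/-- With `M = z I - A`, replacing `A` by `z I - M` gives `C M⁻¹ A + C = z C M⁻¹`. -/
theorem LTISystem.stateResponse_tf {X U Y : Type*} [Fintype X] [DecidableEq X]
    (G : LTISystem X U Y) {z : ℂ} (hz : z ∉ spectrum ℂ (toComplex G.A)) :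
    G.stateResponse.tf z =
      z • (toComplex G.C * (z • (1 : Matrix X X ℂ) - toComplex G.A)⁻¹) := by
  have hu := isUnit_det_resolvent hz
  set M := z • (1 : Matrix X X ℂ) - toComplex G.A with hM
  have hA : toComplex G.A = z • (1 : Matrix X X ℂ) - M := by rw [hM]; abel
  change toComplex G.C * M⁻¹ * toComplex G.A + toComplex G.C = _
  rw [hA, Matrix.mul_sub, Matrix.nonsing_inv_mul_cancel_right _ _ hu]
  simp

/-- The transient becomes a stable frequency response applied to a vector that does not depend on
frequency, so the Taylor bounds for transfer matrices cover leakage too. -/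
theorem transient_eq {X U Y : Type*} [Fintype X] [DecidableEq X] (G : LTISystem X U Y) (N : ℕ)
    (d : X → ℝ) {z : ℂ} (hz : z ∉ spectrum ℂ (toComplex G.A)) (i : Y) :
    transient G N d z i =
      ∑ a, G.stateResponse.tf z i a * (((Real.sqrt N : ℝ) : ℂ)⁻¹ * (d a : ℂ)) := by
  rw [G.stateResponse_tf hz]
  simp only [transient, Pi.smul_apply, Matrix.mulVec, dotProduct, smul_eq_mul, Finset.mul_sum,
    Matrix.smul_apply]
  exact Finset.sum_congr rfl fun a _ => by ring

theorem taylorRemainder_transient {X U Y : Type*} [Fintype X] [DecidableEq X]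
    (G : LTISystem X U Y) (hG : ∀ a ∈ spectrum ℂ (toComplex G.A), ‖a‖ < 1) (R N : ℕ)
    (d : X → ℝ) (i : Y) (a h : ℝ) :
    taylorRemainder R (fun θ => transient G N d (Complex.exp (θ * Complex.I)) i) a h =
      ∑ b, taylorRemainder R (fun θ => G.stateResponse.tf (Complex.exp (θ * Complex.I)) i b) a h *
        (((Real.sqrt N : ℝ) : ℂ)⁻¹ * (d b : ℂ)) := by
  simp_rw [transient_eq G N d (circle_notMem_spectrum hG _)]
  exact taylorRemainder_sum_mul _ R (fun b => G.stateResponse.contDiff_tf hG i b) _ a h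

/-! ### The algebra of local polynomial modeling -/

section Lpm

variable {ι κ : Type*} [Fintype ι] [DecidableEq ι] {R n : ℕ} {k : ℤ} {W : ℤ → ι → ℂ}

/-- The Gram matrix cancels its inverse. The two sets of rows of this identity are the reproduction
and annihilation rules for the weights. -/
theorem regressor_mul_lpmWeight
    (h : IsUnit (regressor R n k W * (regressor R n k W)ᴴ).det) :
    regressor R n k W * lpmWeight R n k W =
      (1 : Matrix ((Fin (R + 1) × ι) ⊕ Fin (R + 1)) ((Fin (R + 1) × ι) ⊕ Fin (R + 1)) ℂ).submatrix
        id fun i => Sum.inl (0, i) := by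
  have := Matrix.mul_nonsing_inv _ h
  rw [Matrix.mul_assoc] at this
  rw [← this]
  ext a j
  simp [lpmWeight, Matrix.mul_apply]

theorem sum_pow_mul_input_mul_lpmWeight
    (h : IsUnit (regressor R n k W * (regressor R n k W)ᴴ).det) {s : ℕ} (hs : s < R + 1)
    (q j : ι) :
    ∑ r : Window n, (r.1 : ℂ) ^ s * W (k + r.1) q * lpmWeight R n k W r j =
      if s = 0 ∧ q = j then 1 else 0 := by
  have := congrFun (congrFun (regressor_mul_lpmWeight h) (Sum.inl (⟨s, hs⟩, q))) j
  simp only [Matrix.mul_apply, regressor, Matrix.of_apply, Sum.elim_inl] at this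
  rw [this]
  simp [Matrix.one_apply, Fin.ext_iff]

theorem sum_pow_mul_lpmWeight
    (h : IsUnit (regressor R n k W * (regressor R n k W)ᴴ).det) {s : ℕ} (hs : s < R + 1) (j : ι) :
    ∑ r : Window n, (r.1 : ℂ) ^ s * lpmWeight R n k W r j = 0 := by
  have := congrFun (congrFun (regressor_mul_lpmWeight h) (Sum.inr ⟨s, hs⟩)) j
  simp only [Matrix.mul_apply, regressor, Matrix.of_apply, Sum.elim_inr] at this
  rw [this]
  simp

theorem binFreq_add (N : ℕ) (k r : ℤ) :
    binFreq N (k + r) = binFreq N k + 2 * Real.pi * r / N := by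
  simp only [binFreq]; push_cast; ring

/-- Makes the Taylor polynomial a polynomial in the integer offset `r` with coefficients free of
`r`, the form in which the powers in the regressor act on it. -/
theorem apply_binFreq_add (R N : ℕ) (k r : ℤ) (f : ℝ → ℂ) :
    f (binFreq N (k + r)) = (∑ s ∈ Finset.range (R + 1),
      iteratedDeriv s f (binFreq N k) / (Nat.factorial s : ℂ) * (2 * Real.pi / N : ℂ) ^ s *
        (r : ℂ) ^ s) + taylorRemainder R f (binFreq N k) (2 * Real.pi * r / N) := by
  rw [binFreq_add, taylorRemainder, add_comm (Finset.sum _ _), ← sub_eq_iff_eq_add, sub_right_inj]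
  refine Finset.sum_congr rfl fun s _ => ?_
  push_cast
  rw [mul_assoc, ← mul_pow]
  ring_nf

/-- LPM is exact on polynomial transfer functions: only the Taylor remainder is left. -/
theorem sum_apply_mul_input_mul_lpmWeight
    (h : IsUnit (regressor R n k W * (regressor R n k W)ᴴ).det) (N : ℕ) (f : ℝ → ℂ) (q j : ι) :
    ∑ r : Window n, f (binFreq N (k + r.1)) * W (k + r.1) q * lpmWeight R n k W r j =
      (if q = j then f (binFreq N k) else 0) +
      ∑ r : Window n, taylorRemainder R f (binFreq N k) (2 * Real.pi * r.1 / N) *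
        W (k + r.1) q * lpmWeight R n k W r j := by
  simp_rw [apply_binFreq_add R N k _ f, add_mul, Finset.sum_add_distrib, Finset.sum_mul]
  congr 1
  rw [Finset.sum_comm]
  have (s : ℕ) (hs : s ∈ Finset.range (R + 1)) : ∑ r : Window n,
      iteratedDeriv s f (binFreq N k) / (Nat.factorial s : ℂ) * (2 * Real.pi / N : ℂ) ^ s *
        (r.1 : ℂ) ^ s * W (k + r.1) q * lpmWeight R n k W r j =
      iteratedDeriv s f (binFreq N k) / (Nat.factorial s : ℂ) * (2 * Real.pi / N : ℂ) ^ s *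
        if s = 0 ∧ q = j then 1 else 0 := by
    rw [← sum_pow_mul_input_mul_lpmWeight h (Finset.mem_range.1 hs), Finset.mul_sum]
    exact Finset.sum_congr rfl fun r _ => by ring
  rw [Finset.sum_congr rfl this, Finset.sum_range_succ']
  simp

/-- LPM rejects polynomial transients: only the Taylor remainder is left. -/
theorem sum_apply_mul_lpmWeight
    (h : IsUnit (regressor R n k W * (regressor R n k W)ᴴ).det) (N : ℕ) (f : ℝ → ℂ) (j : ι) :
    ∑ r : Window n, f (binFreq N (k + r.1)) * lpmWeight R n k W r j =
      ∑ r : Window n, taylorRemainder R f (binFreq N k) (2 * Real.pi * r.1 / N) *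
        lpmWeight R n k W r j := by
  simp_rw [apply_binFreq_add R N k _ f, add_mul, Finset.sum_add_distrib, Finset.sum_mul]
  rw [add_eq_right, Finset.sum_comm]
  refine Finset.sum_eq_zero fun s hs => ?_
  rw [← mul_zero (iteratedDeriv s f (binFreq N k) / (Nat.factorial s : ℂ) *
    (2 * Real.pi / N : ℂ) ^ s), ← sum_pow_mul_lpmWeight h (Finset.mem_range.1 hs) j, Finset.mul_sum]
  exact Finset.sum_congr rfl fun r _ => by ring

/-- The LPM estimate is the transfer matrix plus the LPM weights applied to the Taylor remainders
of the response and of the transient, and to the noise. -/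
theorem lpmEstimate_eq {X : Type*} [Fintype X] [DecidableEq X]
    (h : IsUnit (regressor R n k W * (regressor R n k W)ᴴ).det) (N : ℕ) (G : LTISystem X ι κ)
    (d : X → ℝ) {V E : ℤ → κ → ℂ}
    (hV : ∀ k : ℤ, V k = G.tf (Complex.exp (binFreq N k * Complex.I)) *ᵥ W k +
      transient G N d (Complex.exp (binFreq N k * Complex.I)) + E k) :
    lpmEstimate R n k W V = G.tf (Complex.exp (binFreq N k * Complex.I)) +
      (Matrix.of (fun (i : κ) (r : Window n) =>
        ∑ q, taylorRemainder R (fun θ => G.tf (Complex.exp (θ * Complex.I)) i q)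
          (binFreq N k) (2 * Real.pi * r.1 / N) * W (k + r.1) q) * lpmWeight R n k W +
      Matrix.of (fun (i : κ) (r : Window n) =>
        taylorRemainder R (fun θ => transient G N d (Complex.exp (θ * Complex.I)) i)
          (binFreq N k) (2 * Real.pi * r.1 / N)) * lpmWeight R n k W) +
      windowMatrix n k E * lpmWeight R n k W := by
  ext i j
  have h1 := fun q => sum_apply_mul_input_mul_lpmWeight h N
    (fun θ => G.tf (Complex.exp (θ * Complex.I)) i q) q j
  have h2 := sum_apply_mul_lpmWeight h N
    (fun θ => transient G N d (Complex.exp (θ * Complex.I)) i) j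
  simp only [lpmEstimate, windowMatrix, Matrix.mul_apply, Matrix.of_apply, Matrix.add_apply, hV,
    Pi.add_apply, add_mul, Finset.sum_add_distrib, Matrix.mulVec, dotProduct]
  rw [h2, ← add_assoc]
  congr 2
  simp_rw [Finset.sum_mul]
  rw [Finset.sum_comm, Finset.sum_congr rfl fun q _ => h1 q, Finset.sum_add_distrib,
    Finset.sum_comm (s := Finset.univ (α := ι))]
  simp

end Lpm

/-! ### The order of the LPM errors -/

theorem frobenius_norm_le_of_entry_le {m n : Type*} [Fintype m] [Fintype n] {A : Matrix m n ℂ}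
    {b : ℝ} (h : ∀ i j, ‖A i j‖ ≤ b) : ‖A‖ ≤ Fintype.card m * Fintype.card n * b := by
  classical
  rw [Matrix.matrix_eq_sum_single A]
  refine (norm_sum_le _ _).trans ?_
  have (i : m) : ‖∑ j, Matrix.single i j (A i j)‖ ≤ Fintype.card n * b := by
    refine (norm_sum_le _ _).trans ?_
    refine (Finset.sum_le_card_nsmul _ _ b fun j _ => ?_).trans (by simp)
    have : ‖Matrix.single i j (A i j)‖ = ‖A i j‖ := by
      rw [Matrix.frobenius_norm_def]
      rw [Finset.sum_eq_single i, Finset.sum_eq_single j]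
      · rw [← Real.rpow_mul (norm_nonneg _)]; norm_num
      · intro b _ hb; simp [hb.symm]
      · simp
      · intro b _ hb; simp [hb.symm]
      · simp
    rw [this]; exact h i j
  refine (Finset.sum_le_card_nsmul _ _ _ fun i _ => this i).trans ?_
  simp [mul_assoc]

theorem integral_sum_sum_mul {Ω α β : Type*} [MeasurableSpace Ω] {μ : Measure Ω} (s : Finset α)
    (t : Finset β) {f : α → β → Ω → ℂ} (hf : ∀ a b, Integrable (f a b) μ) (c : α → β → ℂ) :
    ∫ ω, ∑ a ∈ s, ∑ b ∈ t, c a b * f a b ω ∂μ = ∑ a ∈ s, ∑ b ∈ t, c a b * ∫ ω, f a b ω ∂μ := by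
  rw [integral_finsetSum _ fun a _ => integrable_finsetSum _ fun b _ => (hf a b).const_mul _]
  refine Finset.sum_congr rfl fun a _ => ?_
  rw [integral_finsetSum _ fun b _ => (hf a b).const_mul _]
  exact Finset.sum_congr rfl fun b _ => integral_const_mul _ _

theorem norm_sum_mul_le {α β γ δ : Type*} [Fintype α] [Fintype β] [Fintype γ] [Fintype δ] {c : ℝ}
    {A : α → Matrix β γ ℂ} (hA : ∀ r, ‖A r‖ ≤ c) (B : α → Matrix γ δ ℂ) :
    ‖∑ r, A r * B r‖ ≤ c * ∑ r, ‖B r‖ := by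
  rw [Finset.mul_sum]
  refine (norm_sum_le _ _).trans (Finset.sum_le_sum fun r _ => ?_)
  exact (Matrix.frobenius_norm_mul _ _).trans
    (mul_le_mul_of_nonneg_right (hA r) (norm_nonneg _))

section Order

variable {Ω X ι κ : Type*} [MeasurableSpace Ω] [Fintype X] [DecidableEq X]
  [Fintype ι] [DecidableEq ι] {μ : Measure Ω} {R n : ℕ} {k : ℤ} {W : Ω → ℤ → ι → ℂ}
  {d : Ω → X → ℝ}

/-- The Taylor remainders are deterministic and leave the expectation, so the data enter only
through cross moments with the weights. -/
theorem interpolationError_eq (N : ℕ) (G : LTISystem X ι κ)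
    (hW : ∀ (r : Window n) q j,
      Integrable (fun ω => W ω (k + r.1) q * lpmWeight R n k (W ω) r j) μ) :
    interpolationError μ R n N k G W = ∑ r : Window n,
      Matrix.of (fun i q => taylorRemainder R (fun θ => G.tf (Complex.exp (θ * Complex.I)) i q)
          (binFreq N k) (2 * Real.pi * r.1 / N)) *
      expect μ fun ω => Matrix.vecMulVec (W ω (k + r.1)) (lpmWeight R n k (W ω) r) := by
  ext i j
  simp only [interpolationError, expect, Matrix.of_apply, Matrix.mul_apply, Matrix.sum_apply,
    Matrix.vecMulVec_apply, Finset.sum_mul, mul_assoc]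
  exact integral_sum_sum_mul _ _ (fun r q => hW r q j) _

theorem leakageError_eq (N : ℕ) (G : LTISystem X ι κ)
    (hG : ∀ a ∈ spectrum ℂ (toComplex G.A), ‖a‖ < 1)
    (hd : ∀ (r : Window n) a j,
      Integrable (fun ω => (d ω a : ℂ) * lpmWeight R n k (W ω) r j) μ) :
    leakageError μ R n N k G W d = ∑ r : Window n,
      (((Real.sqrt N : ℝ) : ℂ)⁻¹ • Matrix.of (fun i q =>
        taylorRemainder R (fun θ => G.stateResponse.tf (Complex.exp (θ * Complex.I)) i q)
          (binFreq N k) (2 * Real.pi * r.1 / N))) *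
      expect μ fun ω => Matrix.vecMulVec (fun a => (d ω a : ℂ)) (lpmWeight R n k (W ω) r) := by
  ext i j
  simp only [leakageError, expect, Matrix.of_apply, Matrix.mul_apply, Matrix.sum_apply,
    Matrix.vecMulVec_apply, taylorRemainder_transient G hG, Finset.sum_mul, Matrix.smul_apply,
    smul_eq_mul]
  rw [← integral_sum_sum_mul _ _ (fun r a => hd r a j)]
  congr 1
  funext ω
  exact Finset.sum_congr rfl fun r _ => Finset.sum_congr rfl fun a _ => by ring

theorem window_abs_le (N : ℕ) (r : Window n) :
    |2 * Real.pi * (r.1 : ℝ) / N| ≤ 2 * Real.pi * ((n : ℝ) / N) := by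
  have hr := Finset.mem_Icc.1 r.2
  have : |(r.1 : ℝ)| ≤ n := by
    rw [abs_le]; exact ⟨by exact_mod_cast hr.1, by exact_mod_cast hr.2⟩
  rw [abs_div, abs_mul, abs_of_pos (by positivity : 0 < 2 * Real.pi), Nat.abs_cast, mul_div_assoc]
  gcongr

theorem LTISystem.exists_norm_taylorRemainder_tf_le {U Y : Type*} [Fintype U] [Fintype Y]
    (G : LTISystem X U Y) (hG : ∀ a ∈ spectrum ℂ (toComplex G.A), ‖a‖ < 1) (R : ℕ) :
    ∃ M : ℝ, 0 ≤ M ∧ ∀ (N n : ℕ) (a : ℝ) (r : Window n), ‖Matrix.of (fun i j =>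
      taylorRemainder R (fun θ => G.tf (Complex.exp (θ * Complex.I)) i j) a
        (2 * Real.pi * r.1 / N))‖ ≤ M * ((n : ℝ) / N) ^ (R + 1) := by
  obtain ⟨M, hM0, hM⟩ := G.exists_taylorRemainder_tf_le hG R
  refine ⟨Fintype.card Y * Fintype.card U * (M * (2 * Real.pi) ^ (R + 1)), by positivity,
    fun N n a r => (frobenius_norm_le_of_entry_le fun i j =>
      (hM i j a (2 * Real.pi * r.1 / N)).trans (mul_le_mul_of_nonneg_left
        (pow_le_pow_left₀ (abs_nonneg _) (window_abs_le N r) _) hM0)).trans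
          (le_of_eq ?_)⟩
  rw [mul_pow]; ring

theorem sum_window_zero_eq_zero {E : Type*} [AddCommMonoid E] {f : Window 0 → E}
    (h : ∀ r : Window 0, r.1 = 0 → f r = 0) : ∑ r, f r = 0 :=
  Finset.sum_eq_zero fun r _ => h r (by have := Finset.mem_Icc.1 r.2; simp at this; omega)

/-- Settles `n = 0`, where `1 / √N ≤ √N * (n / N)` fails and the second leakage bound needs a
separate argument. -/
theorem leakageError_window_zero (N : ℕ) (G : LTISystem X ι κ) :
    leakageError μ R 0 N k G W d = 0 := by
  ext i j
  simp only [leakageError, expect, Matrix.of_apply, Matrix.mul_apply]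
  rw [Matrix.zero_apply, ← integral_zero Ω ℂ (μ := μ)]
  congr 1
  funext ω
  exact sum_window_zero_eq_zero fun r hr => by simp [hr, taylorRemainder_at_zero]

end Order

theorem exists_norm_leakageError_le {X ι κ : Type*} [Fintype X] [DecidableEq X] [Fintype ι]
    [DecidableEq ι] [Fintype κ] (G : LTISystem X ι κ)
    (hG : ∀ a ∈ spectrum ℂ (toComplex G.A), ‖a‖ < 1) (R : ℕ) :
    ∃ C : ℝ, 0 ≤ C ∧ ∀ {Ω : Type*} [MeasurableSpace Ω] (μ : Measure Ω) (N n : ℕ) (k : ℤ)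
      (W : Ω → ℤ → ι → ℂ) (d : Ω → X → ℝ),
      (∀ (r : Window n) a j, Integrable (fun ω => (d ω a : ℂ) * lpmWeight R n k (W ω) r j) μ) →
      ‖leakageError μ R n N k G W d‖ ≤
        C * (crossMoment μ R n k W (fun ω _ a => (d ω a : ℂ)) *
          ((Real.sqrt N)⁻¹ * ((n : ℝ) / N) ^ (R + 1))) := by
  obtain ⟨M, hM0, hM⟩ := G.stateResponse.exists_norm_taylorRemainder_tf_le hG R
  refine ⟨M, hM0, fun μ N n k W d hd => ?_⟩
  rw [leakageError_eq N G hG hd]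
  refine (norm_sum_mul_le (c := (Real.sqrt N)⁻¹ * (M * ((n : ℝ) / N) ^ (R + 1)))
    (fun r => ?_) _).trans (le_of_eq ?_)
  · rw [norm_smul, norm_inv, Complex.norm_real, Real.norm_of_nonneg (Real.sqrt_nonneg _)]
    gcongr
    exact hM N n _ r
  · simp only [crossMoment]; ring

/-- The interpolation error is expanded to one degree higher than the leakage. Its term of degree `R
+ 1` gives `Oint`; the remainder of degree `R + 1` joins the leakage in `Oleak`. -/
theorem LTISystem.exists_hasLPMOrder {X ι κ : Type*} [Fintype X] [DecidableEq X] [Fintype ι]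
    [DecidableEq ι] [Fintype κ] (G : LTISystem X ι κ)
    (hG : ∀ a ∈ spectrum ℂ (toComplex G.A), ‖a‖ < 1) (R : ℕ) :
    ∃ C : ℝ, 0 ≤ C ∧ ∀ {Ω : Type*} [MeasurableSpace Ω] (μ : Measure Ω) (N n : ℕ) (k : ℤ)
      (W : Ω → ℤ → ι → ℂ) (d : Ω → X → ℝ), 0 < N →
      (∀ (r : Window n) q j,
        Integrable (fun ω => W ω (k + r.1) q * lpmWeight R n k (W ω) r j) μ) →
      (∀ (r : Window n) a j, Integrable (fun ω => (d ω a : ℂ) * lpmWeight R n k (W ω) r j) μ) →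
      HasLPMOrder C μ R n N k G W d := by
  obtain ⟨M, hM0, hM⟩ := G.exists_norm_taylorRemainder_tf_le hG (R + 1)
  obtain ⟨L, hL0, hL⟩ := exists_norm_leakageError_le G hG R
  -- The summands serve in turn `Oint`, the higher interpolation remainder and the leakage; their
  -- sum serves all the bounds at once.
  refine ⟨(2 * Real.pi) ^ (R + 1) + M + L, by positivity, fun μ N n k W d hN hW hd => ?_⟩
  have hN' : (0 : ℝ) < N := by exact_mod_cast hN
  set T : ℝ := (2 * Real.pi) ^ (R + 1)
  have hT0 : 0 ≤ T := by positivity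
  set m := crossMoment μ R n k W (fun ω r => W ω (k + r.1)) with hm
  set ν := crossMoment μ R n k W (fun ω _ a => (d ω a : ℂ)) with hν
  have hm0 : 0 ≤ m := Finset.sum_nonneg fun _ _ => norm_nonneg _
  have hν0 : 0 ≤ ν := Finset.sum_nonneg fun _ _ => norm_nonneg _
  set Q : Window n → Matrix ι ι ℂ := fun r =>
    expect μ fun ω => Matrix.vecMulVec (W ω (k + r.1)) (lpmWeight R n k (W ω) r) with hQ
  set I₂ : Matrix κ ι ℂ := ∑ r : Window n, Matrix.of (fun i q =>
    taylorRemainder (R + 1) (fun θ => G.tf (Complex.exp (θ * Complex.I)) i q)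
      (binFreq N k) (2 * Real.pi * r.1 / N)) * Q r with hI₂
  have hI₂le : ‖I₂‖ ≤ M * m * ((n : ℝ) / N) ^ (R + 2) :=
    (norm_sum_mul_le (fun r => hM N n _ r) _).trans (le_of_eq (by
      simp only [hm, crossMoment, hQ]; ring))
  have hLle := hL μ N n k W d hd
  have hL2 : ‖leakageError μ R n N k G W d‖ ≤ L * (Real.sqrt N * ν) * ((n : ℝ) / N) ^ (R + 2) := by
    rcases Nat.eq_zero_or_pos n with rfl | hn
    · rw [leakageError_window_zero]; simp
    · refine hLle.trans ?_
      -- Multiplied by `√N` this reads `1 ≤ n`. It trades the factor `1 / √N` for one more power of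
      -- `n / N`.
      have h1 : (Real.sqrt N)⁻¹ ≤ Real.sqrt N * ((n : ℝ) / N) := by
        have hs : 0 < Real.sqrt N := Real.sqrt_pos.2 hN'
        have hn' : (1 : ℝ) ≤ n := by exact_mod_cast hn
        rw [inv_le_iff_one_le_mul₀' hs, ← mul_assoc, Real.mul_self_sqrt hN'.le,
          mul_div_cancel₀ _ hN'.ne']
        exact hn'
      calc L * (ν * ((Real.sqrt N)⁻¹ * ((n : ℝ) / N) ^ (R + 1)))
          ≤ L * (ν * ((Real.sqrt N * ((n : ℝ) / N)) * ((n : ℝ) / N) ^ (R + 1))) := by gcongr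
        _ = _ := by ring
  -- The derivative in the Taylor term does not depend on `r`, so it factors out on the left and
  -- leaves scalar multiples of the cross moments.
  refine ⟨∑ r : Window n, ((((2 * Real.pi * r.1 / N : ℝ) : ℂ) ^ (R + 1) /
    (Nat.factorial (R + 1) : ℂ)) • (1 : Matrix ι ι ℂ)) * Q r,
    I₂ + leakageError μ R n N k G W d, ?_, ?_, ?_, ?_⟩
  · rw [lpmError, interpolationError_eq N G hW, ← add_assoc, Matrix.mul_sum, hI₂,
      ← Finset.sum_add_distrib]
    congr 1
    refine Finset.sum_congr rfl fun r _ => ?_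
    rw [← Matrix.mul_assoc, ← Matrix.add_mul]
    congr 1
    ext i q
    simp only [Matrix.of_apply, Matrix.add_apply, freqDeriv, Matrix.mul_smul, Matrix.mul_one,
      Matrix.smul_apply, smul_eq_mul]
    rw [taylorRemainder_eq_add_succ]
    ring
  · have hQs : ∑ r, ‖Q r‖ = m := rfl
    refine (norm_sum_le _ _).trans ?_
    have h1 (r : Window n) : ‖((((2 * Real.pi * r.1 / N : ℝ) : ℂ) ^ (R + 1) /
        (Nat.factorial (R + 1) : ℂ)) • (1 : Matrix ι ι ℂ)) * Q r‖ ≤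
          T * ((n : ℝ) / N) ^ (R + 1) * ‖Q r‖ := by
      rw [Matrix.smul_mul, Matrix.one_mul, norm_smul]
      gcongr
      rw [norm_div, norm_pow, Complex.norm_real, Complex.norm_natCast, Real.norm_eq_abs, ← mul_pow]
      refine (div_le_self (by positivity) (by exact_mod_cast Nat.factorial_pos _)).trans ?_
      exact pow_le_pow_left₀ (abs_nonneg _) (window_abs_le N r) _
    refine (Finset.sum_le_sum fun r _ => h1 r).trans ?_
    rw [← Finset.mul_sum, hQs]
    have : 0 ≤ (M + L) * m * ((n : ℝ) / N) ^ (R + 1) := by positivity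
    nlinarith
  · refine (norm_add_le _ _).trans ((add_le_add hI₂le hLle).trans ?_)
    set a := ((n : ℝ) / N) ^ (R + 2)
    set b := (Real.sqrt N)⁻¹ * ((n : ℝ) / N) ^ (R + 1)
    have ha : 0 ≤ m * a := by positivity
    have hb : 0 ≤ ν * b := by positivity
    have h1 := mul_nonneg (add_nonneg hT0 hL0) ha
    have h2 := mul_nonneg (add_nonneg hT0 hM0) hb
    linarith
  · refine (norm_add_le _ _).trans ((add_le_add hI₂le hL2).trans ?_)
    set a := ((n : ℝ) / N) ^ (R + 2)
    have ha : 0 ≤ m * a := by positivity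
    have hb : 0 ≤ Real.sqrt N * ν * a := by positivity
    have h1 := mul_nonneg (add_nonneg hT0 hL0) ha
    have h2 := mul_nonneg (add_nonneg hT0 hM0) hb
    linarith

/-! ### Real matrices as complex ones -/

section ToComplex

variable {l m n : Type*}

theorem toComplex_mul [Fintype m] (M : Matrix l m ℝ) (N : Matrix m n ℝ) :
    toComplex (M * N) = toComplex M * toComplex N := Matrix.map_mul (f := algebraMap ℝ ℂ)

theorem toComplex_add (M N : Matrix m n ℝ) : toComplex (M + N) = toComplex M + toComplex N := by
  ext; simp [toComplex]

theorem toComplex_sub (M N : Matrix m n ℝ) : toComplex (M - N) = toComplex M - toComplex N := by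
  ext; simp [toComplex]

theorem toComplex_neg (M : Matrix m n ℝ) : toComplex (-M) = -toComplex M := by
  ext; simp [toComplex]

theorem toComplex_one [DecidableEq m] : toComplex (1 : Matrix m m ℝ) = 1 := by
  ext i j; by_cases h : i = j <;> simp [toComplex, Matrix.one_apply, h]

theorem toComplex_pow [Fintype m] [DecidableEq m] (M : Matrix m m ℝ) (k : ℕ) :
    toComplex (M ^ k) = toComplex M ^ k := by
  induction k with
  | zero => simp [toComplex_one]
  | succ k ih => rw [pow_succ, pow_succ, toComplex_mul, ih]

theorem toComplex_fromBlocks {o : Type*} (A : Matrix n l ℝ) (B : Matrix n m ℝ) (C : Matrix o l ℝ)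
    (D : Matrix o m ℝ) : toComplex (Matrix.fromBlocks A B C D) =
      Matrix.fromBlocks (toComplex A) (toComplex B) (toComplex C) (toComplex D) :=
  Matrix.fromBlocks_map _ _ _ _ _

theorem toComplex_fromRows (A : Matrix l n ℝ) (B : Matrix m n ℝ) :
    toComplex (Matrix.fromRows A B) = Matrix.fromRows (toComplex A) (toComplex B) := by
  ext (i | i) j <;> rfl

theorem toComplex_fromCols (A : Matrix n l ℝ) (B : Matrix n m ℝ) :
    toComplex (Matrix.fromCols A B) = Matrix.fromCols (toComplex A) (toComplex B) := by
  ext i (j | j) <;> rfl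

end ToComplex

/-! ### The feedback loop at a single frequency -/

/-- Returns from a transfer matrix to state equations, so that open-loop responses can be fed into
the loop equations. -/
theorem LTISystem.exists_state_tf_eq {X U Y : Type*} [Fintype X] [DecidableEq X] [Fintype U]
    (G : LTISystem X U Y) {z : ℂ} (hG : z ∉ spectrum ℂ (toComplex G.A)) (u : U → ℂ) :
    ∃ x : X → ℂ, z • x = toComplex G.A *ᵥ x + toComplex G.B *ᵥ u ∧
      G.tf z *ᵥ u = toComplex G.C *ᵥ x + toComplex G.D *ᵥ u := by
  have hdet := isUnit_det_resolvent hG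
  refine ⟨(z • (1 : Matrix X X ℂ) - toComplex G.A)⁻¹ *ᵥ (toComplex G.B *ᵥ u), ?_, ?_⟩
  · rw [← sub_eq_iff_eq_add', ← Matrix.one_mulVec (z • _), Matrix.mulVec_smul,
      ← Matrix.smul_mulVec, ← Matrix.sub_mulVec, Matrix.mulVec_mulVec,
      Matrix.mul_nonsing_inv _ hdet, Matrix.one_mulVec]
  · simp only [LTISystem.tf, Matrix.add_mulVec, Matrix.mulVec_mulVec, Matrix.mul_assoc]

section Loop

variable {X Z U Y : Type*} [Fintype X] [Fintype Z] [Fintype U] [DecidableEq U]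
  [Fintype Y] [DecidableEq Y]

/-- The closed-loop system from the output noise `v` in `y = G u + v`, `u = r - K y` to the
input `u`. -/
noncomputable def inputNoiseSensitivity (G : LTISystem X U Y) (K : LTISystem Z Y U) : LTISystem (X ⊕ Z) Y U :=
  let E : Matrix U U ℝ := (1 + K.D * G.D)⁻¹
  { A := (inputSensitivity G K).A
    B := Matrix.fromRows (-(G.B * E * K.D)) (K.B * (1 - G.D * E * K.D))
    C := (inputSensitivity G K).C
    D := -(E * K.D) }

/-- The closed-loop system from the output noise `v` in `y = G u + v`, `u = r - K y` to the
output `y`. -/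
noncomputable def outputNoiseSensitivity (G : LTISystem X U Y) (K : LTISystem Z Y U) : LTISystem (X ⊕ Z) Y Y :=
  let E : Matrix U U ℝ := (1 + K.D * G.D)⁻¹
  { A := (inputSensitivity G K).A
    B := (inputNoiseSensitivity G K).B
    C := (processSensitivity G K).C
    D := 1 - G.D * E * K.D }

variable {G : LTISystem X U Y} {K : LTISystem Z Y U} {z : ℂ} {x d₁ : X → ℂ} {ξ d₂ : Z → ℂ}
  {u r : U → ℂ} {y v : Y → ℂ}

/-- Substituting the output equation into the feedback law leaves the algebraic loop `(1 + K.D G.D)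
u = …`, which the regularity hypothesis inverts. -/
theorem loop_input_eq (hE : IsUnit (1 + K.D * G.D).det)
    (hy : y = toComplex G.C *ᵥ x + toComplex G.D *ᵥ u + v)
    (hu : u = r - (toComplex K.C *ᵥ ξ + toComplex K.D *ᵥ y)) :
    u = toComplex (inputSensitivity G K).C *ᵥ Sum.elim x ξ +
      toComplex (inputSensitivity G K).D *ᵥ r + toComplex (inputNoiseSensitivity G K).D *ᵥ v := by
  have h1 := congrArg toComplex (Matrix.nonsing_inv_mul _ hE)
  set E := (1 + K.D * G.D)⁻¹ with hEdef
  rw [toComplex_mul, toComplex_add, toComplex_mul, toComplex_one] at h1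
  have h2 : (1 + toComplex K.D * toComplex G.D) *ᵥ u =
      r - toComplex K.C *ᵥ ξ - toComplex K.D *ᵥ (toComplex G.C *ᵥ x) - toComplex K.D *ᵥ v := by
    rw [Matrix.add_mulVec, Matrix.one_mulVec, ← Matrix.mulVec_mulVec]
    nth_rewrite 1 [hu]
    rw [hy, Matrix.mulVec_add, Matrix.mulVec_add]
    abel
  have h3 : u = toComplex E *ᵥ ((1 + toComplex K.D * toComplex G.D) *ᵥ u) := by
    rw [Matrix.mulVec_mulVec, h1, Matrix.one_mulVec]
  rw [h3, h2]
  simp only [inputSensitivity, inputNoiseSensitivity, ← hEdef, toComplex_fromCols, toComplex_neg,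
    toComplex_mul, Matrix.fromCols_mulVec, Sum.elim_comp_inl, Sum.elim_comp_inr,
    Matrix.mulVec_sub, Matrix.neg_mulVec, Matrix.mulVec_mulVec, Matrix.mul_assoc]
  abel

theorem loop_output_eq (hE : IsUnit (1 + K.D * G.D).det)
    (hy : y = toComplex G.C *ᵥ x + toComplex G.D *ᵥ u + v)
    (hu : u = r - (toComplex K.C *ᵥ ξ + toComplex K.D *ᵥ y)) :
    y = toComplex (processSensitivity G K).C *ᵥ Sum.elim x ξ +
      toComplex (processSensitivity G K).D *ᵥ r +
      toComplex (outputNoiseSensitivity G K).D *ᵥ v := by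
  rw [hy, loop_input_eq hE hy hu]
  simp only [inputSensitivity, inputNoiseSensitivity, processSensitivity, outputNoiseSensitivity,
    toComplex_fromCols, toComplex_neg, toComplex_sub, toComplex_one,
    toComplex_mul, Matrix.fromCols_mulVec, Sum.elim_comp_inl, Sum.elim_comp_inr,
    Matrix.mulVec_add, Matrix.sub_mulVec, Matrix.neg_mulVec, Matrix.mulVec_neg,
    Matrix.mulVec_mulVec, Matrix.mul_assoc, Matrix.one_mulVec]
  abel

/-- The forcings `d₁`, `d₂` make room for the boundary terms of the DFT shift; with zero forcing the
same equation describes transfer matrices. -/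
theorem loop_state_eq (hE : IsUnit (1 + K.D * G.D).det)
    (hx : z • x = toComplex G.A *ᵥ x + toComplex G.B *ᵥ u + d₁)
    (hy : y = toComplex G.C *ᵥ x + toComplex G.D *ᵥ u + v)
    (hξ : z • ξ = toComplex K.A *ᵥ ξ + toComplex K.B *ᵥ y + d₂)
    (hu : u = r - (toComplex K.C *ᵥ ξ + toComplex K.D *ᵥ y)) :
    z • Sum.elim x ξ = toComplex (inputSensitivity G K).A *ᵥ Sum.elim x ξ +
      toComplex (inputSensitivity G K).B *ᵥ r + toComplex (inputNoiseSensitivity G K).B *ᵥ v +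
      Sum.elim d₁ d₂ := by
  have h1 : z • Sum.elim x ξ = Sum.elim (z • x) (z • ξ) := by
    ext (a | a) <;> rfl
  rw [h1, hx, hξ, loop_output_eq hE hy hu, loop_input_eq hE hy hu]
  simp only [inputSensitivity, inputNoiseSensitivity, processSensitivity, outputNoiseSensitivity,
    toComplex_fromCols, toComplex_fromRows, toComplex_fromBlocks, toComplex_neg, toComplex_sub,
    toComplex_one, toComplex_mul, Matrix.fromCols_mulVec, Matrix.fromRows_mulVec,
    Matrix.fromBlocks_mulVec, Sum.elim_comp_inl, Sum.elim_comp_inr,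
    Matrix.mulVec_add, Matrix.sub_mulVec, Matrix.neg_mulVec, Matrix.mulVec_neg, Matrix.mulVec_sub,
    Matrix.mul_sub, Matrix.mul_one,
    Matrix.mulVec_mulVec, Matrix.mul_assoc, Matrix.one_mulVec]
  ext (a | a) <;> simp only [Sum.elim_inl, Sum.elim_inr, Pi.add_apply, Pi.sub_apply, Pi.neg_apply]
    <;> ring

variable [DecidableEq X] [DecidableEq Z]

/-- The signals in the loop at a complex frequency, in terms of the excitation, the noise and
the forcing `d` of the states. -/
theorem loop_response (hE : IsUnit (1 + K.D * G.D).det)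
    (hz : z ∉ spectrum ℂ (toComplex (inputSensitivity G K).A))
    (hx : z • x = toComplex G.A *ᵥ x + toComplex G.B *ᵥ u + d₁)
    (hy : y = toComplex G.C *ᵥ x + toComplex G.D *ᵥ u + v)
    (hξ : z • ξ = toComplex K.A *ᵥ ξ + toComplex K.B *ᵥ y + d₂)
    (hu : u = r - (toComplex K.C *ᵥ ξ + toComplex K.D *ᵥ y)) :
    u = (inputSensitivity G K).tf z *ᵥ r + (toComplex (inputSensitivity G K).C *
        (z • (1 : Matrix (X ⊕ Z) (X ⊕ Z) ℂ) - toComplex (inputSensitivity G K).A)⁻¹) *ᵥ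
          Sum.elim d₁ d₂ + (inputNoiseSensitivity G K).tf z *ᵥ v ∧
    y = (processSensitivity G K).tf z *ᵥ r + (toComplex (processSensitivity G K).C *
        (z • (1 : Matrix (X ⊕ Z) (X ⊕ Z) ℂ) - toComplex (processSensitivity G K).A)⁻¹) *ᵥ
          Sum.elim d₁ d₂ + (outputNoiseSensitivity G K).tf z *ᵥ v := by
  have h := loop_state_eq hE hx hy hξ hu
  have h1 := loop_input_eq hE hy hu
  have h2 := loop_output_eq hE hy hu
  have hdet := isUnit_det_resolvent hz
  set A := toComplex (inputSensitivity G K).A with hA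
  have h3 : Sum.elim x ξ = (z • (1 : Matrix (X ⊕ Z) (X ⊕ Z) ℂ) - A)⁻¹ *ᵥ
      (toComplex (inputSensitivity G K).B *ᵥ r + toComplex (inputNoiseSensitivity G K).B *ᵥ v +
      Sum.elim d₁ d₂) := by
    have h4 : (z • (1 : Matrix (X ⊕ Z) (X ⊕ Z) ℂ) - A) *ᵥ Sum.elim x ξ =
        toComplex (inputSensitivity G K).B *ᵥ r + toComplex (inputNoiseSensitivity G K).B *ᵥ v +
        Sum.elim d₁ d₂ := by
      rw [Matrix.sub_mulVec, Matrix.smul_mulVec, Matrix.one_mulVec, h]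
      abel
    rw [← h4, Matrix.mulVec_mulVec, Matrix.nonsing_inv_mul _ hdet, Matrix.one_mulVec]
  constructor
  · rw [h1, h3]
    change _ = (toComplex (inputSensitivity G K).C * (z • 1 - A)⁻¹ *
      toComplex (inputSensitivity G K).B + toComplex (inputSensitivity G K).D) *ᵥ r + _ +
      (toComplex (inputSensitivity G K).C * (z • 1 - A)⁻¹ *
      toComplex (inputNoiseSensitivity G K).B + toComplex (inputNoiseSensitivity G K).D) *ᵥ v
    simp only [Matrix.mulVec_add, Matrix.add_mulVec, Matrix.mulVec_mulVec, Matrix.mul_assoc]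
    abel
  · rw [h2, h3]
    change _ = (toComplex (processSensitivity G K).C * (z • 1 - A)⁻¹ *
      toComplex (inputSensitivity G K).B + toComplex (processSensitivity G K).D) *ᵥ r +
      (toComplex (processSensitivity G K).C * (z • 1 - A)⁻¹) *ᵥ Sum.elim d₁ d₂ +
      (toComplex (processSensitivity G K).C * (z • 1 - A)⁻¹ *
      toComplex (inputNoiseSensitivity G K).B + toComplex (outputNoiseSensitivity G K).D) *ᵥ v
    simp only [Matrix.mulVec_add, Matrix.add_mulVec, Matrix.mulVec_mulVec, Matrix.mul_assoc]
    abel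

/-- Any `u` is the loop input for the excitation `(1 + K G) u` without noise or forcing. Reading
this off `loop_response` avoids inverting block matrices. -/
theorem closedLoop_tf (hE : IsUnit (1 + K.D * G.D).det)
    (hz : z ∉ spectrum ℂ (toComplex (inputSensitivity G K).A))
    (hG : z ∉ spectrum ℂ (toComplex G.A)) (hK : z ∉ spectrum ℂ (toComplex K.A)) :
    (inputSensitivity G K).tf z * (1 + K.tf z * G.tf z) = 1 ∧
      (processSensitivity G K).tf z * (1 + K.tf z * G.tf z) = G.tf z := by
  have key (u : U → ℂ) : u = (inputSensitivity G K).tf z *ᵥ ((1 + K.tf z * G.tf z) *ᵥ u) ∧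
      G.tf z *ᵥ u = (processSensitivity G K).tf z *ᵥ ((1 + K.tf z * G.tf z) *ᵥ u) := by
    obtain ⟨x, hx, hy⟩ := G.exists_state_tf_eq hG u
    obtain ⟨ξ, hξ, hc⟩ := K.exists_state_tf_eq hK (G.tf z *ᵥ u)
    have h0 : Sum.elim (0 : X → ℂ) (0 : Z → ℂ) = 0 := by ext (a | a) <;> rfl
    have := loop_response (d₁ := 0) (d₂ := 0) (v := 0) (r := (1 + K.tf z * G.tf z) *ᵥ u) hE hz
      (by simpa using hx) (by simpa using hy) (by simpa using hξ) (by
        rw [← hc, Matrix.add_mulVec, Matrix.one_mulVec, Matrix.mulVec_mulVec]; abel)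
    simpa only [h0, Matrix.mulVec_zero, add_zero] using this
  constructor
  · refine Matrix.ext_of_mulVec_single fun i => ?_
    rw [← Matrix.mulVec_mulVec, ← (key _).1, Matrix.one_mulVec]
  · refine Matrix.ext_of_mulVec_single fun i => ?_
    rw [← Matrix.mulVec_mulVec, ← (key _).2]

theorem closedLoop_regular (hE : IsUnit (1 + K.D * G.D).det)
    (hz : z ∉ spectrum ℂ (toComplex (inputSensitivity G K).A))
    (hG : z ∉ spectrum ℂ (toComplex G.A)) (hK : z ∉ spectrum ℂ (toComplex K.A)) :
    (inputSensitivity G K).tf z * (1 + K.tf z * G.tf z) = 1 ∧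
      (1 + G.tf z * K.tf z) * (processSensitivity G K).tf z = G.tf z ∧
      IsUnit (1 + G.tf z * K.tf z).det ∧
      G.tf z = (processSensitivity G K).tf z * ((inputSensitivity G K).tf z)⁻¹ := by
  obtain ⟨h1, h2⟩ := closedLoop_tf hE hz hG hK
  set S := (inputSensitivity G K).tf z
  set J := (processSensitivity G K).tf z
  have h3 : (1 + K.tf z * G.tf z) * S = 1 := mul_eq_one_comm.1 h1
  have h4 : J = G.tf z * S := by
    rw [← h2, Matrix.mul_assoc, h3, Matrix.mul_one]
  refine ⟨h1, ?_, ?_, ?_⟩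
  · calc (1 + G.tf z * K.tf z) * J = G.tf z * ((1 + K.tf z * G.tf z) * S) := by
          rw [h4, Matrix.add_mul, Matrix.add_mul, Matrix.mul_add, Matrix.one_mul, Matrix.one_mul]
          simp only [Matrix.mul_assoc]
      _ = G.tf z := by rw [h3, Matrix.mul_one]
  -- Sylvester's identity passes from `1 + G K` to `1 + K G`, which has a left inverse by `h1`.
  · rw [Matrix.det_one_add_mul_comm]
    exact Matrix.isUnit_det_of_left_inverse h1
  · rw [Matrix.inv_eq_right_inv h1, h2]

end Loop

/-! ### The lifted loop -/

section Lifted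

variable {X Z U Y : Type*} [Fintype X] [DecidableEq X] [Fintype U] [DecidableEq U] [Fintype Y] [DecidableEq Y] {F : ℕ}

theorem liftedDownsampler_mul_apply [NeZero F] {α : Type*} (M : Matrix (Fin F × Y) α ℝ) (i : Y)
    (j : α) : (liftedDownsampler F Y * M) i j = M (0, i) j := by
  simp only [Matrix.mul_apply, liftedDownsampler, Matrix.of_apply]
  rw [Finset.sum_eq_single (0, i)]
  · simp
  · rintro ⟨a, b⟩ _ h
    rw [if_neg, zero_mul]
    rintro ⟨h1, h2⟩
    exact h (Prod.ext (Fin.ext (by simpa using h1)) h2.symm)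
  · simp

/-- Sylvester's identity moves the hold to the other side. The downsampler then selects the first
block row of the block lower triangular feedthrough, whose only nonzero block is `P.D`, so both
determinants agree. -/
theorem isUnit_det_lifted [NeZero F] {P : LTISystem X U Y} {K : LTISystem Z Y U}
    (h : IsUnit (1 + K.D * P.D).det) :
    IsUnit (1 + (K.sampledHeld F).D * (P.lift F).D).det := by
  have h1 : liftedDownsampler F Y * (P.lift F).D * liftedHold F U = P.D := by
    ext i j
    rw [Matrix.mul_assoc, liftedDownsampler_mul_apply]
    simp only [Matrix.mul_apply, LTISystem.lift, liftedHold, Matrix.of_apply, Fintype.sum_prod_type]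
    rw [Finset.sum_eq_single 0]
    · simp
    · intro b _ hb
      refine Finset.sum_eq_zero fun x _ => ?_
      simp [hb]
    · simp
  have h2 : (K.sampledHeld F).D * (P.lift F).D =
      liftedHold F U * (K.D * (liftedDownsampler F Y * (P.lift F).D)) := by
    simp only [LTISystem.sampledHeld, Matrix.mul_assoc]
  rwa [h2, Matrix.det_one_add_mul_comm, Matrix.mul_assoc, h1]

end Lifted

/-! ### The DFT of the lifted loop -/

section LiftedSignals

variable {X Z U Y : Type*} [Fintype X] [DecidableEq X] [Fintype U] {F : ℕ}

/-- Variation of constants: taking `i = F` gives the lifted state equation, and `i < F` the samples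
inside a period. -/
theorem LTISystem.state_add (G : LTISystem X U Y) {x : ℕ → X → ℝ} {u : ℕ → U → ℝ}
    (hx : ∀ t, x (t + 1) = G.A *ᵥ x t + G.B *ᵥ u t) (t i : ℕ) :
    x (t + i) = G.A ^ i *ᵥ x t +
      ∑ j ∈ Finset.range i, (G.A ^ (i - 1 - j) * G.B) *ᵥ u (t + j) := by
  induction i with
  | zero => simp
  | succ i ih =>
    rw [← add_assoc, hx, ih, Matrix.mulVec_add, Matrix.mulVec_mulVec, ← pow_succ',
      Finset.sum_range_succ, Matrix.mulVec_sum, ← add_assoc]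
    congr 1
    · congr 1
      refine Finset.sum_congr rfl fun j hj => ?_
      have : i + 1 - 1 - j = (i - 1 - j) + 1 := by have := Finset.mem_range.1 hj; omega
      rw [this, pow_succ', Matrix.mulVec_mulVec, Matrix.mul_assoc]
    · simp

theorem LTISystem.lift_B_mulVec (G : LTISystem X U Y) (u : ℕ → U → ℝ) (l : ℕ) :
    (G.lift F).B *ᵥ timeLift F u l =
      ∑ j ∈ Finset.range F, (G.A ^ (F - 1 - j) * G.B) *ᵥ u (l * F + j) := by
  ext a
  rw [Finset.sum_apply, ← Fin.sum_univ_eq_sum_range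
    (fun j => ((G.A ^ (F - 1 - j) * G.B) *ᵥ u (l * F + j)) a)]
  simp only [Matrix.mulVec, dotProduct, LTISystem.lift, Matrix.of_apply, timeLift,
    Fintype.sum_prod_type]

theorem LTISystem.lift_state (G : LTISystem X U Y) {x : ℕ → X → ℝ} {u : ℕ → U → ℝ}
    (hx : ∀ t, x (t + 1) = G.A *ᵥ x t + G.B *ᵥ u t) (l : ℕ) :
    x ((l + 1) * F) = (G.lift F).A *ᵥ x (l * F) + (G.lift F).B *ᵥ timeLift F u l := by
  rw [G.lift_B_mulVec, add_mul, one_mul, G.state_add hx]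
  rfl

theorem LTISystem.lift_D_mulVec (G : LTISystem X U Y) (u : ℕ → U → ℝ) (l : ℕ) (p : Fin F × Y) :
    ((G.lift F).D *ᵥ timeLift F u l) p =
      (G.C *ᵥ ∑ j ∈ Finset.range p.1, (G.A ^ ((p.1 : ℕ) - 1 - j) * G.B) *ᵥ u (l * F + j)) p.2 +
        (G.D *ᵥ u (l * F + p.1)) p.2 := by
  have h1 (j : ℕ) (hj : j ∈ Finset.range p.1) :
      (G.C *ᵥ ((G.A ^ ((p.1 : ℕ) - 1 - j) * G.B) *ᵥ u (l * F + j))) p.2 =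
      ∑ b, (if j < p.1 then (G.C * G.A ^ ((p.1 : ℕ) - j - 1) * G.B) p.2 b
        else if j = p.1 then G.D p.2 b else 0) * u (l * F + j) b := by
    rw [Matrix.mulVec_mulVec, Nat.sub_right_comm, ← Matrix.mul_assoc]
    simp only [if_pos (Finset.mem_range.1 hj), Matrix.mulVec, dotProduct]
  have h2 : (G.D *ᵥ u (l * F + p.1)) p.2 =
      ∑ b, (if (p.1 : ℕ) < p.1 then (G.C * G.A ^ ((p.1 : ℕ) - p.1 - 1) * G.B) p.2 b
        else if (p.1 : ℕ) = p.1 then G.D p.2 b else 0) * u (l * F + p.1) b := by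
    simp [Matrix.mulVec, dotProduct]
  rw [Matrix.mulVec_sum, Finset.sum_apply, Finset.sum_congr rfl h1, h2,
    ← Finset.sum_range_succ (fun j => ∑ b, (if j < p.1 then
      (G.C * G.A ^ ((p.1 : ℕ) - j - 1) * G.B) p.2 b
        else if j = p.1 then G.D p.2 b else 0) * u (l * F + j) b)]
  -- The piecewise feedthrough vanishes for `j > p.1`, so the causal sum may run over the whole
  -- period.
  have h3 : Finset.range (p.1 + 1) ⊆ Finset.range F :=
    Finset.range_subset_range.2 (by have := p.1.2; omega)
  rw [Finset.sum_subset h3]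
  · rw [← Fin.sum_univ_eq_sum_range (fun j => ∑ b, (if j < p.1 then
      (G.C * G.A ^ ((p.1 : ℕ) - j - 1) * G.B) p.2 b
        else if j = p.1 then G.D p.2 b else 0) * u (l * F + j) b)]
    simp only [Matrix.mulVec, dotProduct, LTISystem.lift, Matrix.of_apply, timeLift,
      Fintype.sum_prod_type, Fin.ext_iff]
  · intro j _ hj
    have : ¬ j < p.1 ∧ ¬ j = p.1 := by
      simp only [Finset.mem_range, not_lt] at hj; omega
    simp [this.1, this.2]

theorem LTISystem.lift_output (G : LTISystem X U Y) {x : ℕ → X → ℝ} {u : ℕ → U → ℝ}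
    {y v : ℕ → Y → ℝ} (hx : ∀ t, x (t + 1) = G.A *ᵥ x t + G.B *ᵥ u t)
    (hy : ∀ t, y t = G.C *ᵥ x t + G.D *ᵥ u t + v t) (l : ℕ) :
    timeLift F y l = (G.lift F).C *ᵥ x (l * F) + (G.lift F).D *ᵥ timeLift F u l +
      timeLift F v l := by
  ext p
  have h1 : ((G.lift F).C *ᵥ x (l * F)) p = (G.C *ᵥ (G.A ^ (p.1 : ℕ) *ᵥ x (l * F))) p.2 := by
    rw [Matrix.mulVec_mulVec]
    simp only [Matrix.mulVec, dotProduct, LTISystem.lift, Matrix.of_apply]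
  simp only [Pi.add_apply]
  rw [G.lift_D_mulVec, h1]
  simp only [timeLift]
  rw [hy, G.state_add hx, Matrix.mulVec_add]
  simp only [Pi.add_apply]
  ring

theorem liftedDownsampler_mulVec [NeZero F] [Fintype Y] [DecidableEq Y] (y : ℕ → Y → ℝ) (l : ℕ) :
    liftedDownsampler F Y *ᵥ timeLift F y l = y (l * F) := by
  ext i
  simp only [Matrix.mulVec, dotProduct, liftedDownsampler, Matrix.of_apply, timeLift]
  rw [Finset.sum_eq_single (0, i)]
  · simp
  · rintro ⟨a, b⟩ _ h
    rw [if_neg, zero_mul]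
    rintro ⟨h1, h2⟩
    exact h (Prod.ext (Fin.ext (by simpa using h1)) h2.symm)
  · simp

theorem liftedHold_mulVec [DecidableEq U] (c : U → ℝ) (p : Fin F × U) :
    (liftedHold F U *ᵥ c) p = c p.2 := by
  simp [Matrix.mulVec, dotProduct, liftedHold]

end LiftedSignals

/-! ### Linearity, shift rule and periodicity of the DFT. -/

section Dft

variable {ι κ : Type*}

theorem dft_add (N : ℕ) (s t : ℕ → ι → ℝ) (k : ℤ) :
    dft N (fun l => s l + t l) k = dft N s k + dft N t k := by
  ext i
  simp only [dft, Pi.add_apply, Complex.ofReal_add, add_mul, Finset.sum_add_distrib, mul_add]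

theorem dft_sub (N : ℕ) (s t : ℕ → ι → ℝ) (k : ℤ) :
    dft N (fun l => s l - t l) k = dft N s k - dft N t k := by
  ext i
  simp only [dft, Pi.sub_apply, Complex.ofReal_sub, sub_mul, Finset.sum_sub_distrib, mul_sub]

theorem dft_mulVec [Fintype ι] (N : ℕ) (M : Matrix κ ι ℝ) (s : ℕ → ι → ℝ) (k : ℤ) :
    dft N (fun l => M *ᵥ s l) k = toComplex M *ᵥ dft N s k := by
  ext i
  simp only [dft, Matrix.mulVec, dotProduct, Complex.ofReal_sum, Complex.ofReal_mul, toComplex,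
    Matrix.map_apply, Finset.sum_mul, Finset.mul_sum]
  rw [Finset.sum_comm]
  exact Finset.sum_congr rfl fun _ _ => Finset.sum_congr rfl fun _ _ => by ring

/-- The shifted sum differs from the original only in its end terms, and the exponential equals `1`
at both ends. This difference is the source of every transient. -/
theorem dft_succ {N : ℕ} (hN : 0 < N) (s : ℕ → ι → ℝ) (k : ℤ) :
    dft N (fun l => s (l + 1)) k = Complex.exp (binFreq N k * Complex.I) • dft N s k -
      (((Real.sqrt N : ℝ) : ℂ)⁻¹ * Complex.exp (binFreq N k * Complex.I)) •
        fun i => ((s 0 i - s N i : ℝ) : ℂ) := by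
  ext i
  have hN' : (N : ℂ) ≠ 0 := by exact_mod_cast hN.ne'
  set z := Complex.exp (binFreq N k * Complex.I) with hz
  set g : ℕ → ℂ := fun t =>
    (s t i : ℂ) * Complex.exp (-(2 * Real.pi * t * k / N * Complex.I)) with hg
  have h1 (t : ℕ) : (s (t + 1) i : ℂ) * Complex.exp (-(2 * Real.pi * t * k / N * Complex.I)) =
      z * g (t + 1) := by
    rw [hg, hz, mul_left_comm, ← Complex.exp_add]
    congr 2
    simp only [binFreq]
    push_cast
    ring
  have h2 : g 0 = s 0 i := by simp [hg]
  have h3 : g N = s N i := by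
    have : -(2 * Real.pi * N * k / N * Complex.I) = ((-k : ℤ) : ℂ) * (2 * Real.pi * Complex.I) := by
      push_cast
      field_simp
    simp only [hg]
    rw [this, Complex.exp_int_mul_two_pi_mul_I, mul_one]
  have h4 : ∑ t ∈ Finset.range N, g (t + 1) = ∑ t ∈ Finset.range N, g t + g N - g 0 := by
    rw [← Finset.sum_range_succ, Finset.sum_range_succ', add_sub_cancel_right]
  change _ * ∑ t ∈ Finset.range N,
    (s (t + 1) i : ℂ) * Complex.exp (-(2 * Real.pi * t * k / N * Complex.I)) =
    z * (_ * ∑ t ∈ Finset.range N, g t) - _ * ((s 0 i - s N i : ℝ) : ℂ)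
  rw [Finset.sum_congr rfl fun t _ => h1 t, ← Finset.mul_sum, h4, h2, h3]
  push_cast
  ring

theorem dft_add_period {N : ℕ} (hN : 0 < N) (s : ℕ → ι → ℝ) (k f : ℤ) :
    dft N s (k + f * N) = dft N s k := by
  ext i
  have hN' : (N : ℂ) ≠ 0 := by exact_mod_cast hN.ne'
  simp only [dft]
  congr 1
  refine Finset.sum_congr rfl fun t _ => ?_
  congr 1
  have : -(2 * Real.pi * t * ((k + f * N : ℤ) : ℂ) / N * Complex.I) =
      -(2 * Real.pi * t * k / N * Complex.I) + ((-(t * f) : ℤ) : ℂ) * (2 * Real.pi * Complex.I) := by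
    push_cast
    field_simp
    ring
  rw [this, Complex.exp_add, Complex.exp_int_mul_two_pi_mul_I, mul_one]

end Dft

section Response

variable {X Z U Y : Type*} [Fintype X] [DecidableEq X] [Fintype Z] [DecidableEq Z]
  [Fintype U] [DecidableEq U] [Fintype Y] [DecidableEq Y] {F : ℕ} [NeZero F]
  {P : LTISystem X U Y} {K : LTISystem Z Y U}

/-- The DFTs of the lifted loop signals: the response to the excitation, the transient caused by
the state drop, and the response to the noise. -/
theorem LoopSignals.IsTrajectory.dft_eq {s : LoopSignals X Z U Y} (hs : s.IsTrajectory F P K)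
    (hstab : Stabilizing F P K) {N : ℕ} (hN : 0 < N) (k : ℤ) :
    dft N (timeLift F s.u) k =
      (liftedS F P K).tf (Complex.exp (binFreq N k * Complex.I)) *ᵥ s.dftR F N k +
      transient (liftedS F P K) N (s.stateDrop F N) (Complex.exp (binFreq N k * Complex.I)) +
      (inputNoiseSensitivity (P.lift F) (K.sampledHeld F)).tf
        (Complex.exp (binFreq N k * Complex.I)) *ᵥ dft N (timeLift F s.v) k ∧
    dft N (timeLift F s.y) k =
      (liftedJ F P K).tf (Complex.exp (binFreq N k * Complex.I)) *ᵥ s.dftR F N k +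
      transient (liftedJ F P K) N (s.stateDrop F N) (Complex.exp (binFreq N k * Complex.I)) +
      (outputNoiseSensitivity (P.lift F) (K.sampledHeld F)).tf
        (Complex.exp (binFreq N k * Complex.I)) *ᵥ dft N (timeLift F s.v) k := by
  set z := Complex.exp (binFreq N k * Complex.I) with hz
  set a := ((Real.sqrt N : ℝ) : ℂ)⁻¹ * z with ha
  -- The four lifted loop equations are transformed one by one; the shift rule then turns the two
  -- state recursions into equations at `z` forced by the state drop.
  have hx := congrArg (fun w => dft N w k) (funext fun l => (P.lift_state (F := F) hs.plant_state l))
  have hy := congrArg (fun w => dft N w k)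
    (funext fun l => (P.lift_output (F := F) hs.plant_state hs.plant_output l))
  have hξ := congrArg (fun w => dft N w k) (funext fun l => (show s.ξ (l + 1) =
    (K.sampledHeld F).A *ᵥ s.ξ l + (K.sampledHeld F).B *ᵥ timeLift F s.y l by
      simp only [LTISystem.sampledHeld]
      rw [← Matrix.mulVec_mulVec, liftedDownsampler_mulVec]
      exact hs.controller_state l))
  have hu := congrArg (fun w => dft N w k) (funext fun l => (show timeLift F s.u l =
    timeLift F s.r l - ((K.sampledHeld F).C *ᵥ s.ξ l +
      (K.sampledHeld F).D *ᵥ timeLift F s.y l) by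
      simp only [LTISystem.sampledHeld]
      rw [← Matrix.mulVec_mulVec, ← Matrix.mulVec_mulVec, liftedDownsampler_mulVec,
        ← Matrix.mulVec_mulVec, ← Matrix.mulVec_add, ← hs.controller_output]
      ext p
      rw [Pi.sub_apply, liftedHold_mulVec]
      exact congrFun (hs.plant_input l p.1 p.1.2) p.2))
  simp only [dft_add, dft_sub, dft_mulVec] at hx hy hξ hu
  rw [dft_succ hN (fun l => s.x (l * F)), sub_eq_iff_eq_add] at hx
  rw [dft_succ hN, sub_eq_iff_eq_add] at hξ
  have h := loop_response (isUnit_det_lifted hstab.1)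
    (circle_notMem_spectrum hstab.2 (binFreq N k)) hx hy hξ hu
  have hd : Sum.elim (a • fun i => ((s.x (0 * F) i - s.x (N * F) i : ℝ) : ℂ))
      (a • fun i => ((s.ξ 0 i - s.ξ N i : ℝ) : ℂ)) =
      a • fun b => (s.stateDrop F N b : ℂ) := by
    ext (b | b) <;> simp [LoopSignals.stateDrop]
  simp only [← hz, ← ha, hd, Matrix.mulVec_smul] at h
  exact h

end Response

/-! ### Measurability of the LPM weights -/

section Measurability

variable {α m : Type*} [MeasurableSpace α] [Fintype m] [DecidableEq m]

theorem measurable_matrix_det {M : α → Matrix m m ℂ} (hM : ∀ i j, Measurable fun a => M a i j) :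
    Measurable fun a => (M a).det := by
  simp only [Matrix.det_apply']
  exact Finset.measurable_fun_sum _ fun σ _ =>
    measurable_const.mul (Finset.measurable_fun_prod _ fun i _ => hM _ _)

theorem measurable_matrix_inv {M : α → Matrix m m ℂ} (hM : ∀ i j, Measurable fun a => M a i j)
    (i j : m) : Measurable fun a => (M a)⁻¹ i j := by
  simp only [Matrix.inv_def, Matrix.smul_apply, Ring.inverse_eq_inv', smul_eq_mul,
    Matrix.adjugate_apply]
  refine (measurable_matrix_det hM).inv.mul (measurable_matrix_det fun a b => ?_)
  by_cases h : a = j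
  · subst h; simp
  · simpa [Matrix.updateRow_ne h] using hM a b

/-- Inversion is measurable on the space of all matrices, singular ones included, so it composes
with an almost everywhere measurable matrix. -/
theorem aemeasurable_matrix_inv {μ : Measure α} {M : α → Matrix m m ℂ}
    (hM : ∀ i j, AEMeasurable (fun a => M a i j) μ) (i j : m) :
    AEMeasurable (fun a => (M a)⁻¹ i j) μ := by
  have h1 : AEMeasurable (fun a i j => M a i j) μ :=
    aemeasurable_pi_lambda _ fun i => aemeasurable_pi_lambda _ fun j => hM i j
  have h2 : Measurable fun N : m → m → ℂ => (Matrix.of N)⁻¹ i j :=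
    measurable_matrix_inv (M := fun N : m → m → ℂ => Matrix.of N) (fun i j => by
      simp only [Matrix.of_apply]; fun_prop) i j
  exact h2.comp_aemeasurable h1

theorem measurable_lpmWeight {ι : Type*} [Fintype ι] [DecidableEq ι] {R n : ℕ} {k : ℤ}
    {W : α → ℤ → ι → ℂ} (hW : ∀ l i, Measurable fun a => W a l i) (r : Window n) (j : ι) :
    Measurable fun a => lpmWeight R n k (W a) r j := by
  have hreg (b) (r : Window n) : Measurable fun a => regressor R n k (W a) b r := by
    rcases b with b | b
    · exact measurable_const.mul (hW _ _)
    · exact measurable_const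
  have hregH (b) (r : Window n) : Measurable fun a => (regressor R n k (W a))ᴴ r b := by
    simp only [Matrix.conjTranspose_apply]
    exact continuous_star.measurable.comp (hreg b r)
  simp only [lpmWeight, Matrix.submatrix_apply, id, Matrix.mul_apply]
  refine Finset.measurable_fun_sum _ fun b _ => (hregH b r).mul ?_
  refine measurable_matrix_inv (fun b c => ?_) _ _
  simp only [Matrix.mul_apply]
  exact Finset.measurable_fun_sum _ fun r _ => (hreg b r).mul (hregH c r)

theorem measurable_dft_timeLift {U : Type*} (F N : ℕ) (k : ℤ) (i : Fin F × U) :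
    Measurable fun s : ℕ → U → ℝ => dft N (timeLift F s) k i := by
  simp only [dft, timeLift]
  fun_prop

end Measurability

/-! ### The bias of LPM -/

section Bias

variable {Ω : Type*} [MeasurableSpace Ω] {μ : Measure Ω}

theorem integrable_dft_timeLift {Y : Type*} {v : Ω → ℕ → Y → ℝ}
    (hv : ∀ t i, Integrable (fun ω => v ω t i) μ) (F N : ℕ) (k : ℤ) (i : Fin F × Y) :
    Integrable (fun ω => dft N (timeLift F (v ω)) k i) μ := by
  simp only [dft, timeLift]
  exact (integrable_finsetSum _ fun t _ => (hv _ _).ofReal.mul_const _).const_mul _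

theorem integral_dft_timeLift {Y : Type*} {v : Ω → ℕ → Y → ℝ}
    (hv : ∀ t i, Integrable (fun ω => v ω t i) μ) (hm : ∀ t i, ∫ ω, v ω t i ∂μ = 0) (F N : ℕ)
    (k : ℤ) (i : Fin F × Y) : ∫ ω, dft N (timeLift F (v ω)) k i ∂μ = 0 := by
  simp only [dft, timeLift]
  rw [integral_const_mul, integral_finsetSum _ fun t _ => (hv _ _).ofReal.mul_const _,
    Finset.sum_eq_zero, mul_zero]
  intro t _
  rw [integral_mul_const, integral_complex_ofReal, hm]
  simp

/-- The part of an LPM estimate that stems from independent zero-mean noise has mean zero. -/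
theorem noise_mul_lpmWeight {U Y : Type*} [Fintype U] [DecidableEq U] {F N R n : ℕ} {k : ℤ}
    {r : Ω → ℕ → U → ℝ} {v : Ω → ℕ → Y → ℝ} (hind : IndepFun r v μ)
    (hv : ∀ t i, Integrable (fun ω => v ω t i) μ) (hm : ∀ t i, ∫ ω, v ω t i ∂μ = 0)
    (hw : ∀ (p : Window n) j,
      Integrable (fun ω => lpmWeight R n k (dft N (timeLift F (r ω))) p j) μ)
    (l : ℤ) (q : Fin F × Y) (p : Window n) (j : Fin F × U) :
    Integrable (fun ω => dft N (timeLift F (v ω)) l q *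
      lpmWeight R n k (dft N (timeLift F (r ω))) p j) μ ∧
    ∫ ω, dft N (timeLift F (v ω)) l q *
      lpmWeight R n k (dft N (timeLift F (r ω))) p j ∂μ = 0 := by
  have h1 : Measurable fun s : ℕ → U → ℝ => lpmWeight R n k (dft N (timeLift F s)) p j :=
    measurable_lpmWeight (fun l i => measurable_dft_timeLift F N l i) p j
  -- The noise DFT is a measurable function of `v` alone and the weight one of `r` alone, so
  -- independence passes to them.
  have h2 := hind.symm.comp (measurable_dft_timeLift F N l q) h1
  have h3 := integrable_dft_timeLift hv F N l q
  refine ⟨h2.integrable_mul h3 (hw p j), ?_⟩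
  have := h2.integral_fun_mul_eq_mul_integral h3.aestronglyMeasurable (hw p j).aestronglyMeasurable
  refine this.trans ?_
  rw [show ∫ ω, ((fun s => dft N (timeLift F s) l q) ∘ v) ω ∂μ = 0 from
    integral_dft_timeLift hv hm F N l q, zero_mul]

/-- The exact decomposition holds where the regressor has full rank, hence almost surely.
Integrating it term by term removes the noise and leaves the two error terms. -/
theorem lpmEstimate_bias [IsProbabilityMeasure μ] {X ι κ κ' : Type*} [Fintype X] [DecidableEq X]
    [Fintype ι] [DecidableEq ι] [Fintype κ'] {R n N : ℕ} {k : ℤ} (G : LTISystem X ι κ)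
    (hG : ∀ a ∈ spectrum ℂ (toComplex G.A), ‖a‖ < 1) {W : Ω → ℤ → ι → ℂ} {d : Ω → X → ℝ}
    {V : Ω → ℤ → κ → ℂ} {E : Ω → ℤ → κ' → ℂ} (H : ℤ → Matrix κ κ' ℂ)
    (hV : ∀ ω (k : ℤ), V ω k = G.tf (Complex.exp (binFreq N k * Complex.I)) *ᵥ W ω k +
      transient G N (d ω) (Complex.exp (binFreq N k * Complex.I)) + H k *ᵥ E ω k)
    (hexc : ∀ᵐ ω ∂μ, IsUnit (regressor R n k (W ω) * (regressor R n k (W ω))ᴴ).det)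
    (hW : ∀ (r : Window n) q j,
      Integrable (fun ω => W ω (k + r.1) q * lpmWeight R n k (W ω) r j) μ)
    (hd : ∀ (r : Window n) a j,
      Integrable (fun ω => (d ω a : ℂ) * lpmWeight R n k (W ω) r j) μ)
    (hE : ∀ l q (r : Window n) j,
      Integrable (fun ω => E ω l q * lpmWeight R n k (W ω) r j) μ ∧
      ∫ ω, E ω l q * lpmWeight R n k (W ω) r j ∂μ = 0) :
    (∀ i j, Integrable (fun ω => lpmEstimate R n k (W ω) (V ω) i j) μ) ∧
    (expect μ fun ω => lpmEstimate R n k (W ω) (V ω)) -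
      G.tf (Complex.exp (binFreq N k * Complex.I)) = lpmError μ R n N k G W d := by
  set g := G.tf (Complex.exp (binFreq N k * Complex.I))
  set A : Ω → Matrix κ ι ℂ := fun ω => Matrix.of (fun (i : κ) (r : Window n) =>
    ∑ q, taylorRemainder R (fun θ => G.tf (Complex.exp (θ * Complex.I)) i q)
      (binFreq N k) (2 * Real.pi * r.1 / N) * W ω (k + r.1) q) * lpmWeight R n k (W ω) with hA
  set B : Ω → Matrix κ ι ℂ := fun ω => Matrix.of (fun (i : κ) (r : Window n) =>
    taylorRemainder R (fun θ => transient G N (d ω) (Complex.exp (θ * Complex.I)) i)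
      (binFreq N k) (2 * Real.pi * r.1 / N)) * lpmWeight R n k (W ω) with hB
  set D : Ω → Matrix κ ι ℂ := fun ω =>
    windowMatrix n k (fun k => H k *ᵥ E ω k) * lpmWeight R n k (W ω) with hD
  have hest : ∀ᵐ ω ∂μ, lpmEstimate R n k (W ω) (V ω) = g + (A ω + B ω) + D ω := by
    filter_upwards [hexc] with ω h
    exact lpmEstimate_eq h N G (d ω) (hV ω)
  have hAi (i j) : Integrable (fun ω => A ω i j) μ := by
    simp only [hA, Matrix.mul_apply, Matrix.of_apply, Finset.sum_mul, mul_assoc]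
    exact integrable_finsetSum _ fun r _ => integrable_finsetSum _ fun q _ =>
      (hW r q j).const_mul _
  have hBi (i j) : Integrable (fun ω => B ω i j) μ := by
    simp only [hB, Matrix.mul_apply, Matrix.of_apply, taylorRemainder_transient G hG,
      Finset.sum_mul, mul_assoc]
    exact integrable_finsetSum _ fun r _ => integrable_finsetSum _ fun q _ =>
      ((hd r q j).const_mul _).const_mul _
  have hDi (i j) : Integrable (fun ω => D ω i j) μ ∧ ∫ ω, D ω i j ∂μ = 0 := by
    simp only [hD, Matrix.mul_apply, windowMatrix, Matrix.of_apply, Matrix.mulVec, dotProduct,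
      Finset.sum_mul, mul_assoc]
    refine ⟨integrable_finsetSum _ fun r _ => integrable_finsetSum _ fun q _ =>
      (hE _ q r j).1.const_mul _, ?_⟩
    rw [integral_sum_sum_mul _ _ (f := fun (r : Window n) q ω =>
      E ω (k + r.1) q * lpmWeight R n k (W ω) r j) (fun r q => (hE _ q r j).1)]
    exact Finset.sum_eq_zero fun r _ => Finset.sum_eq_zero fun q _ => by
      rw [(hE _ q r j).2, mul_zero]
  have hent (i j) : (fun ω => lpmEstimate R n k (W ω) (V ω) i j) =ᵐ[μ]
      fun ω => g i j + (A ω i j + B ω i j) + D ω i j := by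
    filter_upwards [hest] with ω h
    rw [h]; rfl
  have hAB (i j) : Integrable (fun ω => A ω i j + B ω i j) μ := (hAi i j).add (hBi i j)
  have hsum (i j) : Integrable (fun ω => g i j + (A ω i j + B ω i j)) μ :=
    (integrable_const _).add (hAB i j)
  refine ⟨fun i j => ((hsum i j).add (hDi i j).1).congr (hent i j).symm, ?_⟩
  ext i j
  change ∫ ω, lpmEstimate R n k (W ω) (V ω) i j ∂μ - g i j =
    ∫ ω, A ω i j ∂μ + ∫ ω, B ω i j ∂μ
  rw [integral_congr_ae (hent i j), integral_add (hsum i j) (hDi i j).1, (hDi i j).2,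
    integral_add (integrable_const _) (hAB i j), integral_add (hAi i j) (hBi i j)]
  simp

end Bias

/-! ### Periodicity of the LPM errors in the bin -/

section Periodicity

variable {Ω X ι κ : Type*} [MeasurableSpace Ω] [Fintype X] [DecidableEq X]
  [Fintype ι] [DecidableEq ι] {R n N : ℕ} {k k' : ℤ}

theorem windowMatrix_congr {W : ℤ → κ → ℂ} (h : ∀ l, W (k' + l) = W (k + l)) :
    windowMatrix n k' W = windowMatrix n k W := by
  ext i r
  simp [windowMatrix, h]

theorem lpmWeight_congr {W : ℤ → ι → ℂ} (h : ∀ l, W (k' + l) = W (k + l)) :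
    lpmWeight R n k' W = lpmWeight R n k W := by
  have : regressor R n k' W = regressor R n k W := by
    ext (a | a) r <;> simp [regressor, h]
  simp only [lpmWeight, this]

theorem lpmError_add_period {μ : Measure Ω} (hN : 0 < N) (G : LTISystem X ι κ)
    {W : Ω → ℤ → ι → ℂ} {d : Ω → X → ℝ} {f : ℤ} (h : ∀ ω l, W ω (l + f * N) = W ω l) :
    lpmError μ R n N (k + f * N) G W d = lpmError μ R n N k G W d := by
  have hN' : (N : ℝ) ≠ 0 := by exact_mod_cast hN.ne'
  have h1 (ω l) : W ω (k + f * N + l) = W ω (k + l) := by rw [add_right_comm, h]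
  have h2 : binFreq N (k + f * N) = binFreq N k + f * (2 * Real.pi) := by
    simp only [binFreq]; push_cast; field_simp
  have h3 {g : ℝ → ℂ} (hg : Function.Periodic g (2 * Real.pi)) (t : ℝ) :
      taylorRemainder R g (binFreq N (k + f * N)) t = taylorRemainder R g (binFreq N k) t := by
    rw [h2, taylorRemainder_add_period R (hg.int_mul f)]
  have h4 (e : X → ℝ) (i : κ) : Function.Periodic
      (fun θ : ℝ => transient G N e (Complex.exp (θ * Complex.I)) i) (2 * Real.pi) := fun θ => by
    have := exp_circle_periodic θ
    simp only at this ⊢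
    rw [this]
  simp only [lpmError, interpolationError, leakageError, h3 (G.tf_periodic _ _), h3 (h4 _ _), h1,
    lpmWeight_congr (h1 _)]

end Periodicity

/-! ### Inverse time lifting -/

/-- Multiply by `z I - A` and telescope the geometric sums: the first summand becomes `z⁻¹ ^ f • A ^
f` and the second `1 - z⁻¹ ^ f • A ^ f`. The shape matches the first block column of a system lifted
by `f + 1`. -/
theorem inv_resolvent_eq_lifted {m : Type*} [Fintype m] [DecidableEq m] {A : Matrix m m ℂ} {z : ℂ}
    (hz : z ≠ 0) (f : ℕ) (h : IsUnit (z ^ (f + 1) • (1 : Matrix m m ℂ) - A ^ (f + 1)).det) :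
    (z • (1 : Matrix m m ℂ) - A)⁻¹ =
      (∑ σ ∈ Finset.range (f + 1), z⁻¹ ^ σ • A ^ σ) *
        (z ^ (f + 1) • (1 : Matrix m m ℂ) - A ^ (f + 1))⁻¹ * A ^ f +
      ∑ σ ∈ Finset.range f, z⁻¹ ^ (σ + 1) • A ^ σ := by
  have hgeom (l : ℕ) : (z • (1 : Matrix m m ℂ) - A) * ∑ σ ∈ Finset.range l, z⁻¹ ^ σ • A ^ σ =
      z • (1 - z⁻¹ ^ l • A ^ l) := by
    have h1 : z • (1 : Matrix m m ℂ) - A = z • (1 - z⁻¹ • A) := by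
      rw [smul_sub, smul_smul, mul_inv_cancel₀ hz, one_smul]
    simp_rw [← smul_pow]
    rw [h1, Matrix.smul_mul, mul_neg_geom_sum]
  have hsucc : ∑ σ ∈ Finset.range f, z⁻¹ ^ (σ + 1) • A ^ σ =
      z⁻¹ • ∑ σ ∈ Finset.range f, z⁻¹ ^ σ • A ^ σ := by
    rw [Finset.smul_sum]
    exact Finset.sum_congr rfl fun σ _ => by rw [smul_smul, pow_succ']
  refine Matrix.inv_eq_right_inv ?_
  rw [Matrix.mul_add, hsucc, Matrix.mul_smul, hgeom, ← Matrix.mul_assoc, ← Matrix.mul_assoc, hgeom]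
  have h2 : z • (1 - z⁻¹ ^ (f + 1) • A ^ (f + 1)) =
      z⁻¹ ^ f • (z ^ (f + 1) • (1 : Matrix m m ℂ) - A ^ (f + 1)) := by
    rw [smul_sub, smul_sub, smul_smul, smul_smul]
    congr 2
    · rw [pow_succ, ← mul_assoc, ← mul_pow, inv_mul_cancel₀ hz, one_pow, one_mul]
    · rw [pow_succ', ← mul_assoc, mul_inv_cancel₀ hz, one_mul]
  rw [h2, Matrix.smul_mul, Matrix.mul_nonsing_inv _ h, smul_smul, inv_mul_cancel₀ hz, one_smul,
    Matrix.smul_mul, Matrix.one_mul]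
  abel

section InverseTimeLift

variable {X U Y : Type*} [Fintype X] [DecidableEq X] {F : ℕ} [NeZero F]

theorem inverseTimeLift_apply (M : Matrix (Fin F × Y) (Fin F × U) ℂ) (z : ℂ) (i : Y) (j : U) :
    inverseTimeLift M z i j = ∑ σ : Fin F, z⁻¹ ^ (σ : ℕ) * M (σ, i) (0, j) := by
  simp [inverseTimeLift, Matrix.sum_apply]

/-- The first block column of the lifted transfer matrix determines the transfer matrix. -/
theorem LTISystem.inverseTimeLift_lift_tf (P : LTISystem X U Y) {z : ℂ} (hz : z ≠ 0)
    (h : z ^ F ∉ spectrum ℂ (toComplex (P.lift F).A)) :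
    inverseTimeLift ((P.lift F).tf (z ^ F)) z = P.tf z := by
  obtain ⟨f, rfl⟩ : ∃ f, F = f + 1 := Nat.exists_eq_succ_of_ne_zero (NeZero.ne F)
  have hdet := isUnit_det_resolvent h
  simp only [LTISystem.lift, toComplex_pow] at hdet
  set A := toComplex P.A
  set Q := (z ^ (f + 1) • (1 : Matrix X X ℂ) - A ^ (f + 1))⁻¹ with hQ
  -- The first input block reaches the end of the period through `A ^ f * B`; the feedthrough
  -- contributes `D` in block `0` and the Markov parameter `C * A ^ (σ - 1) * B` below it.
  have hblock (σ : Fin (f + 1)) : (Matrix.of fun (i : Y) (j : U) =>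
      (P.lift (f + 1)).tf (z ^ (f + 1)) (σ, i) (0, j)) =
      toComplex P.C * (A ^ (σ : ℕ) * Q * A ^ f) * toComplex P.B +
        if (σ : ℕ) = 0 then toComplex P.D
          else toComplex P.C * A ^ ((σ : ℕ) - 1) * toComplex P.B := by
    have h1 : (Matrix.of fun (i : Y) (j : U) =>
      (P.lift (f + 1)).tf (z ^ (f + 1)) (σ, i) (0, j)) =
      toComplex (P.C * P.A ^ (σ : ℕ)) * (z ^ (f + 1) • (1 : Matrix X X ℂ) -
        toComplex (P.A ^ (f + 1)))⁻¹ * toComplex (P.A ^ f * P.B) +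
        toComplex (if (σ : ℕ) = 0 then P.D else P.C * P.A ^ ((σ : ℕ) - 1) * P.B) := by
      ext i j
      simp only [Matrix.of_apply, LTISystem.tf, Matrix.add_apply]
      congr 1
      rcases eq_or_ne σ 0 with rfl | h0
      · simp [LTISystem.lift, toComplex]
      · simp [LTISystem.lift, toComplex, h0, Fin.pos_of_ne_zero h0]
    rw [h1]
    simp only [toComplex_mul, toComplex_pow, apply_ite toComplex, Matrix.mul_assoc]
    rfl
  simp only [inverseTimeLift, hblock, smul_add, Finset.sum_add_distrib]
  rw [Fin.sum_univ_eq_sum_range (fun σ => z⁻¹ ^ σ •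
      (toComplex P.C * (A ^ σ * Q * A ^ f) * toComplex P.B)),
    Fin.sum_univ_eq_sum_range (fun σ => z⁻¹ ^ σ • if σ = 0 then toComplex P.D
      else toComplex P.C * A ^ (σ - 1) * toComplex P.B), Finset.sum_range_succ' (fun σ => z⁻¹ ^ σ •
      if σ = 0 then toComplex P.D else toComplex P.C * A ^ (σ - 1) * toComplex P.B)]
  simp only [Nat.add_one_ne_zero, if_false, if_true, pow_zero, one_smul, Nat.add_sub_cancel]
  rw [LTISystem.tf, inv_resolvent_eq_lifted hz f hdet, ← add_assoc]
  simp only [Matrix.mul_add, Matrix.add_mul, Matrix.mul_sum, Matrix.sum_mul, Matrix.smul_mul,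
    Matrix.mul_smul]
  rfl

end InverseTimeLift

/-! ### Expectations of random matrices -/

/-! ### Frobenius norms of entries, blocks and inverse time lifts. -/

section Frobenius

variable {l m n o : Type*} [Fintype l] [Fintype m] [Fintype n] [Fintype o]

theorem frobenius_norm_sq (A : Matrix m n ℂ) : ‖A‖ ^ 2 = ∑ i, ∑ j, ‖A i j‖ ^ 2 := by
  rw [Matrix.frobenius_norm_def, ← Real.sqrt_eq_rpow, Real.sq_sqrt]
  · simp
  · positivity

theorem norm_entry_le_frobenius_norm (A : Matrix m n ℂ) (i : m) (j : n) : ‖A i j‖ ≤ ‖A‖ := by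
  refine le_of_sq_le_sq ?_ (norm_nonneg _)
  rw [frobenius_norm_sq]
  exact (Finset.single_le_sum (f := fun j => ‖A i j‖ ^ 2) (fun _ _ => sq_nonneg _)
    (Finset.mem_univ j)).trans (Finset.single_le_sum (f := fun i => ∑ j, ‖A i j‖ ^ 2)
      (fun _ _ => Finset.sum_nonneg fun _ _ => sq_nonneg _) (Finset.mem_univ i))

theorem frobenius_norm_submatrix_le (A : Matrix m n ℂ) {f : l → m} {g : o → n}
    (hf : Function.Injective f) (hg : Function.Injective g) : ‖A.submatrix f g‖ ≤ ‖A‖ := by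
  classical
  refine le_of_sq_le_sq ?_ (norm_nonneg _)
  rw [frobenius_norm_sq, frobenius_norm_sq]
  simp only [Matrix.submatrix_apply]
  calc ∑ i, ∑ j, ‖A (f i) (g j)‖ ^ 2 ≤ ∑ i, ∑ b, ‖A (f i) b‖ ^ 2 :=
        Finset.sum_le_sum fun i _ => by
          rw [← Finset.sum_image (f := fun b => ‖A (f i) b‖ ^ 2) (s := Finset.univ) (g := g)
            hg.injOn]
          exact Finset.sum_le_univ_sum_of_nonneg fun _ => sq_nonneg _
    _ ≤ ∑ a, ∑ b, ‖A a b‖ ^ 2 := by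
          rw [← Finset.sum_image (f := fun a => ∑ b, ‖A a b‖ ^ 2) (s := Finset.univ) (g := f)
            hf.injOn]
          exact Finset.sum_le_univ_sum_of_nonneg fun _ =>
            Finset.sum_nonneg fun _ _ => sq_nonneg _

theorem norm_inverseTimeLift_le {F : ℕ} [NeZero F] (M : Matrix (Fin F × m) (Fin F × n) ℂ) {z : ℂ}
    (hz : ‖z‖ = 1) : ‖inverseTimeLift M z‖ ≤ F * ‖M‖ := by
  refine (norm_sum_le _ _).trans ((Finset.sum_le_card_nsmul _ _ ‖M‖ fun σ _ => ?_).trans (by simp))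
  rw [norm_smul, norm_pow, norm_inv, hz, inv_one, one_pow, one_mul]
  exact frobenius_norm_submatrix_le M (f := fun i : m => (σ, i)) (g := fun j : n => ((0 : Fin F), j))
    (Prod.mk_right_injective _) (Prod.mk_right_injective _)

end Frobenius

section Expectation

variable {Ω : Type*} [MeasurableSpace Ω] {μ : Measure Ω} {l m n o : Type*}

theorem expect_sub {M N : Ω → Matrix m n ℂ} (hM : ∀ i j, Integrable (fun ω => M ω i j) μ)
    (hN : ∀ i j, Integrable (fun ω => N ω i j) μ) :
    expect μ (fun ω => M ω - N ω) = expect μ M - expect μ N := by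
  ext i j
  exact integral_sub (hM i j) (hN i j)

theorem expect_congr {M N : Ω → Matrix m n ℂ} (h : ∀ᵐ ω ∂μ, M ω = N ω) :
    expect μ M = expect μ N := by
  ext i j
  refine integral_congr_ae ?_
  filter_upwards [h] with ω hω
  rw [hω]

theorem integrable_const_mul_matrix [Fintype m] (A : Matrix l m ℂ) {M : Ω → Matrix m n ℂ}
    (hM : ∀ i j, Integrable (fun ω => M ω i j) μ) (i : l) (j : n) :
    Integrable (fun ω => (A * M ω) i j) μ := by
  simp only [Matrix.mul_apply]
  exact integrable_finsetSum _ fun a _ => (hM a j).const_mul _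

theorem integrable_matrix_mul_const [Fintype m] {M : Ω → Matrix l m ℂ} (A : Matrix m n ℂ)
    (hM : ∀ i j, Integrable (fun ω => M ω i j) μ) (i : l) (j : n) :
    Integrable (fun ω => (M ω * A) i j) μ := by
  simp only [Matrix.mul_apply]
  exact integrable_finsetSum _ fun a _ => (hM i a).mul_const _

theorem expect_const_mul [Fintype m] (A : Matrix l m ℂ) {M : Ω → Matrix m n ℂ}
    (hM : ∀ i j, Integrable (fun ω => M ω i j) μ) :
    expect μ (fun ω => A * M ω) = A * expect μ M := by
  ext i j
  simp only [expect, Matrix.of_apply, Matrix.mul_apply]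
  rw [integral_finsetSum _ fun a _ => (hM a j).const_mul _]
  exact Finset.sum_congr rfl fun a _ => integral_const_mul _ _

theorem expect_mul_const [Fintype m] {M : Ω → Matrix l m ℂ} (A : Matrix m n ℂ)
    (hM : ∀ i j, Integrable (fun ω => M ω i j) μ) :
    expect μ (fun ω => M ω * A) = expect μ M * A := by
  ext i j
  simp only [expect, Matrix.of_apply, Matrix.mul_apply]
  rw [integral_finsetSum _ fun a _ => (hM i a).mul_const _]
  exact Finset.sum_congr rfl fun a _ => integral_mul_const _ _

theorem integrable_inverseTimeLift {F : ℕ} [NeZero F] {M : Ω → Matrix (Fin F × m) (Fin F × n) ℂ}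
    (hM : ∀ i j, Integrable (fun ω => M ω i j) μ) (z : ℂ) (i : m) (j : n) :
    Integrable (fun ω => inverseTimeLift (M ω) z i j) μ := by
  simp only [inverseTimeLift_apply]
  exact integrable_finsetSum _ fun σ _ => (hM _ _).const_mul _

theorem expect_inverseTimeLift {F : ℕ} [NeZero F] {M : Ω → Matrix (Fin F × m) (Fin F × n) ℂ}
    (hM : ∀ i j, Integrable (fun ω => M ω i j) μ) (z : ℂ) :
    expect μ (fun ω => inverseTimeLift (M ω) z) = inverseTimeLift (expect μ M) z := by
  ext i j
  simp only [expect, Matrix.of_apply, inverseTimeLift_apply]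
  rw [integral_finsetSum _ fun σ _ => (hM _ _).const_mul _]
  exact Finset.sum_congr rfl fun a _ => integral_const_mul _ _

theorem inverseTimeLift_sub {F : ℕ} [NeZero F] (M N : Matrix (Fin F × m) (Fin F × n) ℂ) (z : ℂ) :
    inverseTimeLift (M - N) z = inverseTimeLift M z - inverseTimeLift N z := by
  ext i j
  simp [inverseTimeLift_apply, mul_sub, Finset.sum_sub_distrib]

theorem inverseTimeLift_add {F : ℕ} [NeZero F] (M N : Matrix (Fin F × m) (Fin F × n) ℂ) (z : ℂ) :
    inverseTimeLift (M + N) z = inverseTimeLift M z + inverseTimeLift N z := by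
  ext i j
  simp [inverseTimeLift_apply, mul_add, Finset.sum_add_distrib]

/-- The Frobenius norm is the Euclidean norm of the vector of entries, so the norm inequality for
vector-valued integrals gives the bound without a dimension factor. -/
theorem norm_expect_le [Fintype m] [Fintype n] {M : Ω → Matrix m n ℂ} {g : Ω → ℝ}
    (hM : ∀ i j, Integrable (fun ω => M ω i j) μ) (hg : Integrable g μ)
    (h : ∀ᵐ ω ∂μ, ‖M ω‖ ≤ g ω) : ‖expect μ M‖ ≤ ∫ ω, g ω ∂μ := by
  set e : Matrix m n ℂ → EuclideanSpace ℂ (m × n) := fun A => WithLp.toLp 2 fun p => A p.1 p.2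
    with he
  have hnorm (A : Matrix m n ℂ) : ‖e A‖ = ‖A‖ := by
    rw [← sq_eq_sq₀ (norm_nonneg _) (norm_nonneg _), EuclideanSpace.norm_sq_eq, frobenius_norm_sq,
      Fintype.sum_prod_type]
  have h2 : e (expect μ M) = ∫ ω, e (M ω) ∂μ := by
    ext p
    rw [eval_integral_piLp fun p => hM p.1 p.2]
    rfl
  rw [← hnorm, h2]
  refine norm_integral_le_of_norm_le hg ?_
  filter_upwards [h] with ω hω
  rwa [hnorm]

/-- Expanding around the mean, the cross term integrates to zero. -/
theorem integral_norm_sub_sq [IsProbabilityMeasure μ] {f : Ω → ℂ} (hf : MemLp f 2 μ) (c : ℂ) :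
    ∫ ω, ‖f ω - c‖ ^ 2 ∂μ = ‖(∫ ω, f ω ∂μ) - c‖ ^ 2 + ∫ ω, ‖f ω - ∫ ω, f ω ∂μ‖ ^ 2 ∂μ := by
  set e := ∫ ω, f ω ∂μ with he
  have hi : Integrable f μ := hf.integrable one_le_two
  have hsq : Integrable (fun ω => ‖f ω - e‖ ^ 2) μ :=
    (memLp_two_iff_integrable_sq_norm
      (hf.sub (memLp_const e)).aestronglyMeasurable).1 (hf.sub (memLp_const e))
  have h1 (ω : Ω) : ‖f ω - c‖ ^ 2 =
      ‖e - c‖ ^ 2 + ‖f ω - e‖ ^ 2 + 2 * ((starRingEnd ℂ (e - c)) * (f ω - e)).re := by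
    rw [Complex.sq_norm, Complex.sq_norm, Complex.sq_norm]
    simp [Complex.normSq_apply]
    ring
  have hcross : Integrable (fun ω => (starRingEnd ℂ (e - c)) * (f ω - e)) μ :=
    (hi.sub (integrable_const e)).const_mul _
  have h2 : ∫ ω, ((starRingEnd ℂ (e - c)) * (f ω - e)).re ∂μ = 0 := by
    have h3 : ∫ ω, (starRingEnd ℂ (e - c)) * (f ω - e) ∂μ = 0 := by
      rw [integral_const_mul, integral_sub hi (integrable_const e)]
      simp [he]
    have h4 := integral_re hcross
    simp only [RCLike.re_to_complex] at h4
    rw [h4, h3, Complex.zero_re]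
  have h5 : Integrable (fun ω => ‖e - c‖ ^ 2 + ‖f ω - e‖ ^ 2) μ := (integrable_const _).add hsq
  have h6 : Integrable (fun ω => 2 * ((starRingEnd ℂ (e - c)) * (f ω - e)).re) μ :=
    hcross.re.const_mul 2
  simp_rw [h1]
  rw [integral_add h5 h6, integral_add (integrable_const _) hsq, integral_const_mul, h2]
  simp

theorem integrable_norm_sub_sq [IsFiniteMeasure μ] [Fintype m] [Fintype n] {M : Ω → Matrix m n ℂ}
    (hM : ∀ i j, MemLp (fun ω => M ω i j) 2 μ) (A : Matrix m n ℂ) :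
    Integrable (fun ω => ‖M ω - A‖ ^ 2) μ := by
  simp only [frobenius_norm_sq]
  exact integrable_finsetSum _ fun i _ => integrable_finsetSum _ fun j _ =>
    (memLp_two_iff_integrable_sq_norm
      ((hM i j).sub (memLp_const _)).aestronglyMeasurable).1 ((hM i j).sub (memLp_const (A i j)))

/-- The mean square error is the squared bias plus the variance. -/
theorem integral_frobenius_norm_sub_sq [IsProbabilityMeasure μ] [Fintype m] [Fintype n]
    {M : Ω → Matrix m n ℂ} (hM : ∀ i j, MemLp (fun ω => M ω i j) 2 μ) (A : Matrix m n ℂ) :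
    ∫ ω, ‖M ω - A‖ ^ 2 ∂μ = ‖expect μ M - A‖ ^ 2 + ∫ ω, ‖M ω - expect μ M‖ ^ 2 ∂μ := by
  have hi (B : Matrix m n ℂ) (i j) : Integrable (fun ω => ‖(M ω - B) i j‖ ^ 2) μ :=
    (memLp_two_iff_integrable_sq_norm
      ((hM i j).sub (memLp_const _)).aestronglyMeasurable).1 ((hM i j).sub (memLp_const (B i j)))
  have hsum (B : Matrix m n ℂ) : ∫ ω, ‖M ω - B‖ ^ 2 ∂μ =
      ∑ i, ∑ j, ∫ ω, ‖(M ω - B) i j‖ ^ 2 ∂μ := by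
    simp only [frobenius_norm_sq]
    rw [integral_finsetSum _ fun i _ => integrable_finsetSum _ fun j _ => hi B i j]
    exact Finset.sum_congr rfl fun i _ => integral_finsetSum _ fun j _ => hi B i j
  rw [hsum, hsum, frobenius_norm_sq]
  simp only [← Finset.sum_add_distrib]
  exact Finset.sum_congr rfl fun i _ => Finset.sum_congr rfl fun j _ =>
    integral_norm_sub_sq (hM i j) (A i j)

end Expectation

/-! ### The indirect estimate -/

/-- This is `S'⁻¹ = S⁻¹ - S⁻¹ (S' - S) S'⁻¹` multiplied by `J' - P S'`. When `J = P S` that factor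
is itself an estimation error, which makes the last term quadratic. -/
theorem quotient_estimate_eq {κ ι : Type*} [Fintype κ] [Fintype ι] [DecidableEq ι]
    {S' S : Matrix ι ι ℂ} (hS : IsUnit S.det) (hS' : IsUnit S'.det) (J' P : Matrix κ ι ℂ) :
    J' * S'⁻¹ = P + (J' - P * S') * S⁻¹ - (J' - P * S') * S⁻¹ * (S' - S) * S'⁻¹ := by
  have h1 : (J' - P * S') * S⁻¹ * (S' - S) * S'⁻¹ =
      (J' - P * S') * S⁻¹ - (J' * S'⁻¹ - P) := by
    have e1 : (J' - P * S') * S⁻¹ * S' * S'⁻¹ = (J' - P * S') * S⁻¹ :=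
      Matrix.mul_nonsing_inv_cancel_right _ _ hS'
    have e2 : (J' - P * S') * S⁻¹ * S = J' - P * S' :=
      Matrix.nonsing_inv_mul_cancel_right _ _ hS
    have e3 : (J' - P * S') * S'⁻¹ = J' * S'⁻¹ - P := by
      rw [Matrix.sub_mul, Matrix.mul_nonsing_inv_cancel_right _ _ hS']
    rw [Matrix.mul_sub, Matrix.sub_mul, e1, e2, e3]
  rw [h1]
  abel

/-- Bounded inverses have bounded entries, and an integrable factor times a bounded measurable one
is integrable. -/
theorem integrable_mul_inv {Ω m n : Type*} [MeasurableSpace Ω] {μ : Measure Ω} [Fintype n]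
    [DecidableEq n] {J' : Ω → Matrix m n ℂ} {S' : Ω → Matrix n n ℂ} {κ : ℝ}
    (hJi : ∀ i j, Integrable (fun ω => J' ω i j) μ)
    (hSi : ∀ i j, Integrable (fun ω => S' ω i j) μ) (hκ : ∀ᵐ ω ∂μ, ‖(S' ω)⁻¹‖ ≤ κ) (i j) :
    Integrable (fun ω => (J' ω * (S' ω)⁻¹) i j) μ := by
  simp only [Matrix.mul_apply]
  refine integrable_finsetSum _ fun a _ => (hJi i a).mul_bdd (c := κ)
    (aemeasurable_matrix_inv (fun i j => (hSi i j).aemeasurable) a j).aestronglyMeasurable ?_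
  filter_upwards [hκ] with ω h
  exact (norm_entry_le_frobenius_norm _ a j).trans h

section Quotient

variable {Ω : Type*} [MeasurableSpace Ω] {μ : Measure Ω} [IsProbabilityMeasure μ] {m n : Type*}
  [Fintype m] [Fintype n] [DecidableEq n] {F : ℕ} [NeZero F]
  {J' : Ω → Matrix (Fin F × m) (Fin F × n) ℂ} {S' : Ω → Matrix (Fin F × n) (Fin F × n) ℂ}
  {J P : Matrix (Fin F × m) (Fin F × n) ℂ} {S : Matrix (Fin F × n) (Fin F × n) ℂ} {z : ℂ}

/-- Only the linear term can be averaged in closed form. The remainder is integrable because it is a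
difference of integrable quantities, without any moment condition of its own. -/
theorem quotient_bias (hS : IsUnit S.det) (hP : P = J * S⁻¹)
    (hJi : ∀ i j, Integrable (fun ω => J' ω i j) μ)
    (hSi : ∀ i j, Integrable (fun ω => S' ω i j) μ)
    (hS' : ∀ᵐ ω ∂μ, IsUnit (S' ω).det)
    (hQ : ∀ i j, Integrable (fun ω => inverseTimeLift (J' ω * (S' ω)⁻¹) z i j) μ) :
    (∀ i j, Integrable (fun ω => inverseTimeLift
      ((J' ω - P * S' ω) * S⁻¹ * (S' ω - S) * (S' ω)⁻¹) z i j) μ) ∧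
    expect μ (fun ω => inverseTimeLift (J' ω * (S' ω)⁻¹) z) - inverseTimeLift P z =
      inverseTimeLift (((expect μ J' - J) - P * (expect μ S' - S)) * S⁻¹) z -
        expect μ (fun ω => inverseTimeLift
          ((J' ω - P * S' ω) * S⁻¹ * (S' ω - S) * (S' ω)⁻¹) z) := by
  have hD (i j) : Integrable (fun ω => (J' ω - P * S' ω) i j) μ :=
    (hJi i j).sub (integrable_const_mul_matrix P hSi i j)
  have hL := integrable_matrix_mul_const S⁻¹ hD
  have hLz := integrable_inverseTimeLift hL z
  have hrem : ∀ᵐ ω ∂μ,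
      inverseTimeLift ((J' ω - P * S' ω) * S⁻¹ * (S' ω - S) * (S' ω)⁻¹) z =
        inverseTimeLift P z + inverseTimeLift ((J' ω - P * S' ω) * S⁻¹) z -
          inverseTimeLift (J' ω * (S' ω)⁻¹) z := by
    filter_upwards [hS'] with ω h
    rw [← inverseTimeLift_add, ← inverseTimeLift_sub]
    congr 1
    rw [quotient_estimate_eq hS h (J' ω) P]
    abel
  have hsum (i j) : Integrable (fun ω =>
      (inverseTimeLift P z + inverseTimeLift ((J' ω - P * S' ω) * S⁻¹) z) i j) μ :=
    (integrable_const _).add (hLz i j)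
  have hconst (i j) : Integrable (fun _ : Ω => inverseTimeLift P z i j) μ := integrable_const _
  refine ⟨fun i j => ((hsum i j).sub (hQ i j)).congr ?_, ?_⟩
  · filter_upwards [hrem] with ω h
    rw [h]; rfl
  · have hadd : expect μ (fun ω =>
        inverseTimeLift P z + inverseTimeLift ((J' ω - P * S' ω) * S⁻¹) z) =
        inverseTimeLift P z + expect μ (fun ω =>
          inverseTimeLift ((J' ω - P * S' ω) * S⁻¹) z) := by
      ext i j
      refine (integral_add (hconst i j) (hLz i j)).trans ?_
      simp [expect]
    have hJ : J = P * S := by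
      rw [hP, Matrix.nonsing_inv_mul_cancel_right _ _ hS]
    rw [expect_congr hrem, expect_sub hsum hQ, hadd, expect_inverseTimeLift hL,
      expect_mul_const _ hD, expect_sub hJi (integrable_const_mul_matrix P hSi),
      expect_const_mul P hSi, hJ, Matrix.mul_sub]
    rw [show expect μ J' - P * S - (P * expect μ S' - P * S) = expect μ J' - P * expect μ S' by abel]
    abel

theorem norm_remainder_le (hz : ‖z‖ = 1) (hJ : J = P * S) {κ : ℝ}
    {A : Matrix (Fin F × m) (Fin F × n) ℂ}
    {B : Matrix (Fin F × n) (Fin F × n) ℂ} (hκ : ‖B⁻¹‖ ≤ κ) :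
    ‖inverseTimeLift ((A - P * B) * S⁻¹ * (B - S) * B⁻¹) z‖ ≤
      F * κ * ‖S⁻¹‖ * (1 + ‖P‖) * (‖A - J‖ ^ 2 + ‖B - S‖ ^ 2) := by
  have hκ0 : 0 ≤ κ := (norm_nonneg _).trans hκ
  have h1 : ‖A - P * B‖ ≤ ‖A - J‖ + ‖P‖ * ‖B - S‖ := by
    have : A - P * B = (A - J) - P * (B - S) := by rw [hJ, Matrix.mul_sub]; abel
    rw [this]
    exact (norm_sub_le _ _).trans (add_le_add_right (Matrix.frobenius_norm_mul _ _) _)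
  have h2 : ‖(A - P * B) * S⁻¹ * (B - S) * B⁻¹‖ ≤
      (‖A - J‖ + ‖P‖ * ‖B - S‖) * ‖S⁻¹‖ * ‖B - S‖ * κ := by
    refine (Matrix.frobenius_norm_mul _ _).trans ?_
    gcongr
    refine (Matrix.frobenius_norm_mul _ _).trans ?_
    gcongr
    refine (Matrix.frobenius_norm_mul _ _).trans ?_
    gcongr
  -- With `a`, `b` the two errors, `a b ≤ a² + b²` and `‖P‖ b² ≤ ‖P‖ (a² + b²)`.
  have h3 : (‖A - J‖ + ‖P‖ * ‖B - S‖) * ‖B - S‖ ≤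
      (1 + ‖P‖) * (‖A - J‖ ^ 2 + ‖B - S‖ ^ 2) := by
    have := norm_nonneg P
    have := mul_nonneg this (sq_nonneg ‖A - J‖)
    nlinarith [sq_nonneg (‖A - J‖ - ‖B - S‖), sq_nonneg ‖A - J‖, sq_nonneg ‖B - S‖]
  calc _ ≤ F * ((‖A - J‖ + ‖P‖ * ‖B - S‖) * ‖S⁻¹‖ * ‖B - S‖ * κ) :=
        (norm_inverseTimeLift_le _ hz).trans (by gcongr)
    _ = F * κ * ‖S⁻¹‖ * ((‖A - J‖ + ‖P‖ * ‖B - S‖) * ‖B - S‖) := by ring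
    _ ≤ F * κ * ‖S⁻¹‖ * ((1 + ‖P‖) * (‖A - J‖ ^ 2 + ‖B - S‖ ^ 2)) := by gcongr
    _ = _ := by ring

/-- The second-order remainder is bounded by the mean square errors. -/
theorem norm_expect_remainder_le (hz : ‖z‖ = 1) (hJ : J = P * S) {κ : ℝ}
    (hκ : ∀ᵐ ω ∂μ, ‖(S' ω)⁻¹‖ ≤ κ) (hJ2 : ∀ i j, MemLp (fun ω => J' ω i j) 2 μ)
    (hS2 : ∀ i j, MemLp (fun ω => S' ω i j) 2 μ)
    (hrem : ∀ i j, Integrable (fun ω => inverseTimeLift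
      ((J' ω - P * S' ω) * S⁻¹ * (S' ω - S) * (S' ω)⁻¹) z i j) μ) :
    ‖expect μ (fun ω => inverseTimeLift
      ((J' ω - P * S' ω) * S⁻¹ * (S' ω - S) * (S' ω)⁻¹) z)‖ ≤
      F * κ * ‖S⁻¹‖ * (1 + ‖P‖) * (‖expect μ J' - J‖ ^ 2 + ‖expect μ S' - S‖ ^ 2 +
        ∫ ω, ‖J' ω - expect μ J'‖ ^ 2 ∂μ + ∫ ω, ‖S' ω - expect μ S'‖ ^ 2 ∂μ) := by
  have hg : Integrable (fun ω => F * κ * ‖S⁻¹‖ * (1 + ‖P‖) *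
      (‖J' ω - J‖ ^ 2 + ‖S' ω - S‖ ^ 2)) μ :=
    ((integrable_norm_sub_sq hJ2 J).add (integrable_norm_sub_sq hS2 S)).const_mul _
  refine (norm_expect_le hrem hg ?_).trans (le_of_eq ?_)
  · filter_upwards [hκ] with ω h
    exact norm_remainder_le hz hJ h
  · rw [integral_const_mul, integral_add (integrable_norm_sub_sq hJ2 J)
      (integrable_norm_sub_sq hS2 S), integral_frobenius_norm_sub_sq hJ2 J,
      integral_frobenius_norm_sub_sq hS2 S]
    ring

end Quotient

/-! ### The experiment -/

section Experiment

variable {Ω X Z U Y : Type*} [MeasurableSpace Ω] {μ : Measure Ω} [IsProbabilityMeasure μ]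
  [Fintype X] [DecidableEq X] [Fintype Z] [DecidableEq Z] [Fintype U] [DecidableEq U] [Fintype Y]
  [DecidableEq Y] {F N R n : ℕ} [NeZero F] {k : ℤ} {P : LTISystem X U Y} {K : LTISystem Z Y U}
  {s : Ω → LoopSignals X Z U Y}

theorem IsExperiment.estS_bias (h : IsExperiment μ F N R n k P K s) (hstab : Stabilizing F P K)
    (hN : 0 < N) :
    (∀ i j, Integrable (fun ω => (s ω).estS F N R n k i j) μ) ∧
    (expect μ fun ω => (s ω).estS F N R n k) -
      (liftedS F P K).tf (Complex.exp (binFreq N k * Complex.I)) = errS μ F N R n k P K s :=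
  lpmEstimate_bias (liftedS F P K) hstab.2
    (fun k => (inputNoiseSensitivity (P.lift F) (K.sampledHeld F)).tf
      (Complex.exp (binFreq N k * Complex.I)))
    (fun ω k => ((h.trajectory ω).dft_eq hstab hN k).1) h.exciting h.input_integrable
    h.drop_integrable (fun l q r j => noise_mul_lpmWeight h.indep h.noise_integrable h.noise_mean
      h.weight_integrable l q r j)

theorem IsExperiment.estJ_bias (h : IsExperiment μ F N R n k P K s) (hstab : Stabilizing F P K)
    (hN : 0 < N) :
    (∀ i j, Integrable (fun ω => (s ω).estJ F N R n k i j) μ) ∧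
    (expect μ fun ω => (s ω).estJ F N R n k) -
      (liftedJ F P K).tf (Complex.exp (binFreq N k * Complex.I)) = errJ μ F N R n k P K s :=
  lpmEstimate_bias (liftedJ F P K) hstab.2
    (fun k => (outputNoiseSensitivity (P.lift F) (K.sampledHeld F)).tf
      (Complex.exp (binFreq N k * Complex.I)))
    (fun ω k => ((h.trajectory ω).dft_eq hstab hN k).2) h.exciting h.input_integrable
    h.drop_integrable (fun l q r j => noise_mul_lpmWeight h.indep h.noise_integrable h.noise_mean
      h.weight_integrable l q r j)

end Experiment

/-! ### Periodicity of the plant estimate and the main theorem. -/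

theorem LoopSignals.estP_add_period {X Z U Y : Type*} [Fintype U] [DecidableEq U] {F N : ℕ}
    (hN : 0 < N) (R n : ℕ) (k f : ℤ) (s : LoopSignals X Z U Y) :
    s.estP F N R n (k + f * N) = s.estP F N R n k := by
  have hr (l : ℤ) : dft N (timeLift F s.r) (k + f * N + l) = dft N (timeLift F s.r) (k + l) := by
    rw [add_right_comm, dft_add_period hN]
  have hu (l : ℤ) : dft N (timeLift F s.u) (k + f * N + l) = dft N (timeLift F s.u) (k + l) := by
    rw [add_right_comm, dft_add_period hN]
  have hy (l : ℤ) : dft N (timeLift F s.y) (k + f * N + l) = dft N (timeLift F s.y) (k + l) := by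
    rw [add_right_comm, dft_add_period hN]
  simp only [LoopSignals.estP, LoopSignals.estJ, LoopSignals.estS, lpmEstimate,
    LoopSignals.dftR, windowMatrix_congr hu, windowMatrix_congr hy, lpmWeight_congr hr]

theorem HasLPMOrder.mono {Ω X ι κ : Type*} [MeasurableSpace Ω] [Fintype X] [DecidableEq X]
    [Fintype ι] [DecidableEq ι] [Fintype κ] {C C' : ℝ} {μ : Measure Ω} {R n N : ℕ} {k : ℤ}
    {G : LTISystem X ι κ} {W : Ω → ℤ → ι → ℂ} {d : Ω → X → ℝ}
    (h : HasLPMOrder C μ R n N k G W d) (hC : C ≤ C') : HasLPMOrder C' μ R n N k G W d := by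
  obtain ⟨Oint, Oleak, h0, h1, h2, h3⟩ := h
  have hm {a : Ω → Window n → ι → ℂ} : 0 ≤ crossMoment μ R n k W a :=
    Finset.sum_nonneg fun _ _ => norm_nonneg _
  have hν {a : Ω → Window n → X → ℂ} : 0 ≤ crossMoment μ R n k W a :=
    Finset.sum_nonneg fun _ _ => norm_nonneg _
  refine ⟨Oint, Oleak, h0, h1.trans ?_, h2.trans ?_, h3.trans ?_⟩
  · gcongr
    exact hm
  · gcongr
    exact add_nonneg (mul_nonneg hm (by positivity)) (mul_nonneg hν (by positivity))
  · gcongr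
    exact add_nonneg hm (mul_nonneg (by positivity) hν)

theorem mainTheorem2 {F nx nz nu ny : ℕ} [NeZero F]
    (P : LTISystem (Fin nx) (Fin nu) (Fin ny)) (K : LTISystem (Fin nz) (Fin ny) (Fin nu))
    (hstab : Stabilizing F P K) (R : ℕ) :
    ∃ C : ℝ, ∀ {Ω : Type*} [MeasurableSpace Ω] (μ : Measure Ω) [IsProbabilityMeasure μ]
      (N n : ℕ) (k : ℤ) (s : Ω → LoopSignals (Fin nx) (Fin nz) (Fin nu) (Fin ny))
      (hh hl w : ℝ), 0 < N → 0 < hh → hl = F * hh → w * hl = 2 * Real.pi * k / N →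
      IsExperiment μ F N R n k P K s →
      Complex.exp (w * hl * Complex.I) ∉ spectrum ℂ (toComplex (P.lift F).A) →
      Complex.exp (w * hl * Complex.I) ∉ spectrum ℂ (toComplex K.A) →
      let zl : ℂ := Complex.exp (w * hl * Complex.I)
      let zh : ℂ := Complex.exp (w * hh * Complex.I)
      let Pl := (P.lift F).tf zl
      let Kl := (K.sampledHeld F).tf zl
      let J := (liftedJ F P K).tf zl
      let S := (liftedS F P K).tf zl
      let JΔ := errJ μ F N R n k P K s
      let SΔ := errS μ F N R n k P K s
      let estJ := fun ω => (s ω).estJ F N R n k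
      let estS := fun ω => (s ω).estS F N R n k
      let estP := fun ω => (s ω).estP F N R n k
      -- the lifted closed-loop systems
      (S * (1 + Kl * Pl) = 1 ∧ (1 + Pl * Kl) * J = Pl ∧ IsUnit (1 + Pl * Kl).det ∧
        Pl = J * S⁻¹) ∧
      -- the terms `X_Δ` are the biases of the LPM estimates
      ((∀ i j, Integrable (fun ω => estJ ω i j) μ) ∧ (∀ i j, Integrable (fun ω => estS ω i j) μ) ∧
        expect μ estJ - J = JΔ ∧ expect μ estS - S = SΔ) ∧
      -- their order
      (HasLPMOrder C μ R n N k (liftedJ F P K) (fun ω => (s ω).dftR F N)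
          (fun ω => (s ω).stateDrop F N) ∧
        HasLPMOrder C μ R n N k (liftedS F P K) (fun ω => (s ω).dftR F N)
          (fun ω => (s ω).stateDrop F N)) ∧
      -- the bias of the estimated high-rate plant, with its second-order remainder
      ((∀ᵐ ω ∂μ, IsUnit (estS ω).det) →
        (∀ i j, Integrable (fun ω => inverseTimeLift (estP ω) zh i j) μ) →
        expect μ (fun ω => inverseTimeLift (estP ω) zh) - P.tf zh =
          inverseTimeLift ((JΔ - Pl * SΔ) * S⁻¹) zh -
          expect μ (fun ω => inverseTimeLift
            ((estJ ω - Pl * estS ω) * S⁻¹ * (estS ω - S) * (estS ω)⁻¹) zh)) ∧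
      -- the remainder is quadratic in the LPM errors and the standard deviations
      (∀ κ : ℝ, (∀ᵐ ω ∂μ, IsUnit (estS ω).det ∧ ‖(estS ω)⁻¹‖ ≤ κ) →
        (∀ i j, MemLp (fun ω => estJ ω i j) 2 μ) → (∀ i j, MemLp (fun ω => estS ω i j) 2 μ) →
        (∀ i j, Integrable (fun ω => inverseTimeLift (estP ω) zh i j) μ) ∧
        ‖expect μ (fun ω => inverseTimeLift (estP ω) zh) - P.tf zh -
            inverseTimeLift ((JΔ - Pl * SΔ) * S⁻¹) zh‖ ≤
          F * κ * ‖S⁻¹‖ * (1 + ‖Pl‖) * (‖JΔ‖ ^ 2 + ‖SΔ‖ ^ 2 +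
            ∫ ω, ‖estJ ω - expect μ estJ‖ ^ 2 ∂μ + ∫ ω, ‖estS ω - expect μ estS‖ ^ 2 ∂μ)) ∧
      -- the bias repeats: shifting the frequency by multiples of the low sampling frequency
      -- changes neither the lifted estimates nor the lifted bias
      (∀ f : ℤ,
        Complex.exp ((w + f * (2 * Real.pi / hl)) * hl * Complex.I) = zl ∧
        (∀ ω, (s ω).estP F N R n (k + f * N) = estP ω) ∧
        errJ μ F N R n (k + f * N) P K s = JΔ ∧ errS μ F N R n (k + f * N) P K s = SΔ) := by
  obtain ⟨CJ, hCJ0, hCJ⟩ := (liftedJ F P K).exists_hasLPMOrder hstab.2 R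
  obtain ⟨CS, hCS0, hCS⟩ := (liftedS F P K).exists_hasLPMOrder hstab.2 R
  -- Both constants are fixed by the lifted systems and `R` before any experiment is introduced; the
  -- larger one serves both by `HasLPMOrder.mono`.
  refine ⟨max CJ CS, ?_⟩
  intro Ω _ μ _ N n k s hh hl w hN hh0 hhl hw hexp hPspec hKspec zl zh Pl Kl J S JΔ SΔ estJ estS estP
  have hzl : zl = Complex.exp (binFreq N k * Complex.I) := by
    simp only [zl, binFreq]
    rw [← hw]
    push_cast
    rfl
  have hzh : zh ^ F = zl := by
    simp only [zl, zh]
    rw [← Complex.exp_nat_mul, hhl]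
    push_cast
    ring_nf
  have hzh1 : ‖zh‖ = 1 := by
    simp only [zh]
    rw [← Complex.ofReal_mul, Complex.norm_exp_ofReal_mul_I]
  have hzh0 : zh ≠ 0 := Complex.exp_ne_zero _
  have hE := isUnit_det_lifted (F := F) hstab.1
  have hcl : zl ∉ spectrum ℂ (toComplex (liftedS F P K).A) := by
    rw [hzl]; exact circle_notMem_spectrum hstab.2 _
  have hreg : S * (1 + Kl * Pl) = 1 ∧ (1 + Pl * Kl) * J = Pl ∧ IsUnit (1 + Pl * Kl).det ∧
      Pl = J * S⁻¹ := closedLoop_regular hE hcl hPspec hKspec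
  have hSdet : IsUnit S.det := Matrix.isUnit_det_of_right_inverse hreg.1
  have hJS : J = Pl * S := by
    rw [hreg.2.2.2, Matrix.nonsing_inv_mul_cancel_right _ _ hSdet]
  have hbJ : (∀ i j, Integrable (fun ω => estJ ω i j) μ) ∧ expect μ estJ - J = JΔ := by
    have := hexp.estJ_bias hstab hN
    rwa [← hzl] at this
  have hbS : (∀ i j, Integrable (fun ω => estS ω i j) μ) ∧ expect μ estS - S = SΔ := by
    have := hexp.estS_bias hstab hN
    rwa [← hzl] at this
  -- Since `zh ^ F = zl`, undoing the lifting at `zl` yields the plant at the high-rate frequency.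
  have hPh : inverseTimeLift Pl zh = P.tf zh := by
    have := P.inverseTimeLift_lift_tf (F := F) hzh0 (by rw [hzh]; exact hPspec)
    rwa [hzh] at this
  have hbias := fun h1 h2 => quotient_bias (z := zh) hSdet hreg.2.2.2 hbJ.1 hbS.1 h1 h2
  rw [hbJ.2, hbS.2, hPh] at hbias
  refine ⟨hreg, ⟨hbJ.1, hbS.1, hbJ.2, hbS.2⟩,
    ⟨(hCJ μ N n k _ _ hN hexp.input_integrable hexp.drop_integrable).mono (le_max_left _ _),
      (hCS μ N n k _ _ hN hexp.input_integrable hexp.drop_integrable).mono (le_max_right _ _)⟩,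
    fun h1 h2 => (hbias h1 h2).2, fun κ hκ hJ2 hS2 => ?_, fun f => ⟨?_, ?_, ?_, ?_⟩⟩
  · have hint : ∀ i j, Integrable (fun ω => inverseTimeLift (estP ω) zh i j) μ :=
      integrable_inverseTimeLift (integrable_mul_inv hbJ.1 hbS.1 (hκ.mono fun _ h => h.2)) zh
    refine ⟨hint, ?_⟩
    obtain ⟨hri, hb⟩ := hbias (hκ.mono fun _ h => h.1) hint
    have hr := norm_expect_remainder_le hzh1 hJS (hκ.mono fun _ h => h.2) hJ2 hS2 hri
    rw [hbJ.2, hbS.2] at hr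
    refine le_of_eq_of_le ?_ hr
    -- By the bias formula, the bias minus its linear part is the negative of the remainder that
    -- `hr` bounds.
    rw [← norm_neg]
    congr 1
    refine neg_eq_iff_eq_neg.2 (sub_eq_of_eq_add ?_)
    rw [← sub_eq_neg_add]
    exact hb
  · have hl0 : (hl : ℂ) ≠ 0 := by
      rw [hhl]
      have : (F : ℝ) ≠ 0 := by exact_mod_cast NeZero.ne F
      exact_mod_cast mul_ne_zero this hh0.ne'
    have : (w + f * (2 * Real.pi / hl)) * hl * Complex.I =
        w * hl * Complex.I + f * (2 * Real.pi * Complex.I) := by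
      field_simp
    rw [this, Complex.exp_add, Complex.exp_int_mul_two_pi_mul_I, mul_one]
  · exact fun ω => (s ω).estP_add_period hN R n k f
  · exact lpmError_add_period hN _ fun ω l => dft_add_period hN _ l f
  · exact lpmError_add_period hN _ fun ω l => dft_add_period hN _ l f
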